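/- **Theorem.** An instance of unit-cost Tree Augmentation consists of a finite tree $T=(V,F)$ and a set $E$ of additional undirected edges on $V$; a solution is a set $J\subseteq E$ such that the multigraph $T\cup J$ is 2-edge-connected, and $\mathrm{OPT}$ is the minimum of $|J|$ over all solutions $J$. An edge $uv\in E$ covers an edge $f\in F$ if $f$ lies on the $uv$-path in $T$; for $B\subseteq F$ let $\psi(B)$ be the set of edges in $E$ that cover some $f\in B$. A bunch is a set $B\subseteq F$ of odd size such that no three edges in $B$ lie on the same path in $T$. The 3-Bunch-LP is the linear program of minimizing $\sum_{e\in E}x_e$ over all $x\in\mathbb{R}^E$ with $x\ge 0$ and $$\sum_{e\in\psi(B)}x_e\ \ge\ \frac{|B|+1}{2}\qquad\text{for every bunch } B \text{ with } |B|\le 3;$$ that is, the fractional cover constraints $\sum_{e\in\psi(\{f\})}x_e\ge 1$ for all $f\in F$, together with $\sum_{e\in\psi(B)}x_e\ge 2$ for every bunch $B$ of size $3$. The integrality gap of the 3-Bunch-LP, that is, the supremum over all such instances of the ratio of $\mathrm{OPT}$ to the optimal value of the 3-Bunch-LP, is at most $7/4$. (The optimal value of an infeasible problem is $\infty$; $0/0$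 and $\infty/\infty$ are read as $0$.) -/

import Mathlib

open scoped ENNReal

universe u

namespace TreeAug

/-- A finite multigraph on `V`, given by the end pairs of its edges (parallel edges and loops are
allowed), is 2-edge-connected: it is connected, and stays connected when any one edge is deleted. -/
def IsTwoEdgeConnected {V ι : Type*} (ends : ι → Sym2 V) : Prop :=
  (SimpleGraph.fromEdgeSet (Set.range ends)).Connected ∧
    ∀ e : ι, (SimpleGraph.fromEdgeSet (ends '' {e}ᶜ)).Connected

/-- An instance of unit-cost Tree Augmentation on the node set `V`: a tree `T` and a set `E` of
additional undirected edges (which may include tree edges and loops). -/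
structure Inst (V : Type u) where
  /-- the tree -/
  T : SimpleGraph V
  /-- `T` is a tree -/
  isTree : T.IsTree
  /-- the edges available for augmenting `T` -/
  E : Finset (Sym2 V)

namespace Inst

variable {V : Type u} (I : Inst V)

/-- `J ⊆ E` is a feasible solution: the multigraph `T ∪ J` (the disjoint union of the two edge
sets, so that an edge of `J` may be parallel to a tree edge) is 2-edge-connected. -/
def IsSolution (J : Finset (Sym2 V)) : Prop :=
  J ⊆ I.E ∧ IsTwoEdgeConnected
    (Sum.elim (fun f : I.T.edgeSet => (f : Sym2 V)) (fun e : {e // e ∈ J} => (e : Sym2 V)))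

/-- The minimum number of edges in a feasible solution (`∞` if there is none). -/
noncomputable def opt : ℝ≥0∞ :=
  ⨅ (J : Finset (Sym2 V)) (_ : I.IsSolution J), (J.card : ℝ≥0∞)

/-- The edge `e = uv` covers the tree edge `f`: `f` lies on the `uv`-path of `T`. -/
def Covers (e f : Sym2 V) : Prop :=
  ∃ (u v : V) (p : I.T.Walk u v), e = s(u, v) ∧ p.IsPath ∧ f ∈ p.edges

open Classical in
/-- `ψ(B)`: the edges of `E` that cover some tree edge in `B`. -/
noncomputable def psi (B : Finset (Sym2 V)) : Finset {e // e ∈ I.E} :=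
  Finset.univ.filter fun e => ∃ f ∈ B, I.Covers e f

/-- A bunch: a set of tree edges of odd size, no three of which lie on one path of `T`. -/
def IsBunch (B : Finset (Sym2 V)) : Prop :=
  (∀ f ∈ B, f ∈ I.T.edgeSet) ∧ Odd B.card ∧
    ∀ (u v : V) (p : I.T.Walk u v), p.IsPath →
      ∀ D : Finset (Sym2 V), D ⊆ B → D.card = 3 → ¬ ∀ f ∈ D, f ∈ p.edges

/-- The feasible region of the `k`-Bunch-LP: nonnegative `x ∈ ℝ^E` with
`x(ψ(B)) ≥ (|B| + 1) / 2` for every bunch `B` of size at most `k`. -/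
def bunchPolyhedron (k : ℕ) : Set ({e // e ∈ I.E} → ℝ) :=
  {x | (∀ B : Finset (Sym2 V), I.IsBunch B → B.card ≤ k →
          ((B.card : ℝ) + 1) / 2 ≤ ∑ e ∈ I.psi B, x e) ∧
        ∀ e, 0 ≤ x e}

/-- The optimal value of the unit-cost `k`-Bunch-LP (`∞` if it is infeasible). -/
noncomputable def bunchLPValue (k : ℕ) : ℝ≥0∞ :=
  ⨅ x ∈ I.bunchPolyhedron k, ENNReal.ofReal (∑ e, x e)

end Inst

/-- The integrality gap of the unit-cost `k`-Bunch-LP: the supremum, over all instances, of the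
optimum of Tree Augmentation divided by the optimal LP value. (In `ℝ≥0∞` the conventions
`∞ / ∞ = 0` and `0 / 0 = 0` discard the instances where both problems are infeasible, or where both
optima are `0`; if just the LP were feasible, or just its value were `0`, the ratio would
be `∞`.) -/
noncomputable def bunchIntegralityGap (k : ℕ) : ℝ≥0∞ :=
  ⨆ (V : Type u) (_ : Finite V) (I : Inst V), I.opt / I.bunchLPValue k

end TreeAug

/-!
Root the tree at `r` and order its nodes by descent, so that `r` is the top element. A tree edge is
the edge from a non-root node `v` to its parent, and a link covers it iff exactly one of its ends
is a descendant of `v` (`Separates`). Of the constraints of the `3`-Bunch-LP only two kinds are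
needed: the cut constraints of the single edges, and the *fork* constraints, given by the bunches of
two incomparable edges `u`, `v` and an edge `w` above both, which are covered by links of total
weight at least `2`.

**The initial bound** (`Config.potential_le`). A *stem* is a lowest non-root node with exactly two
leaves below it; links between these two leaves are called *twins*. Let `M` be a maximal matching in
the graph of the leaf-to-leaf links that are not twins, and `Q` the set of unmatched leaves. Then
`7/4 · x(E) ≥ |Q| + |M| / 2 + (∑ deg v, over all nodes v ∉ Q) / 2`. This is a combination of
`2 x(E) ≥ #leaves + x(twins)`, where the fork constraint at a stem pays for its twin links, of
`x(E) + x(twins) ≥ ∑_{v ∈ Q} deg v`, which is the maximality of `M`, and of `deg v ≥ 1` at leaves.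
The right-hand side is the available credit, `Config.potential`.

**The greedy contraction** (`Config.exists_cover`). Links are bought and the tree edges they cover
contracted. A node arising from a contraction joins `Q`, which means that it holds one unit of
credit, and each step has to be paid for, including this unit, by the credit of the nodes that it
merges. If some link joins two nodes of `Q`, then it is bought and its path contracted. Otherwise
let `up l` be the link at a leaf `l` that covers the most ancestors of `l`. If `w` is a lowest node
the tree edge above which is covered neither by `M` nor by a link `up q` for a leaf `q ∈ Q`, then
the links of `M` below `w` and the links `up q` for the leaves `q ∈ Q` below `w` cover the subtree
of `w`. Counting link ends, its credit exceeds their number by at least one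
(`Config.Isolated.card_add_one_le`), unless the subtree is *deficient*: it contains a single link of
`M`, say `pk`, a single node `u` of `Q`, which is a leaf, and its nodes outside `Q` have total degree
less than `3`. In that case `pk` can be replaced by a link `ku`, and `u` by `p` as the leaf that has
to be covered upwards. A fork constraint or the comparison of `x(pu)` with `x(ku)` shows that a
suitable choice of `k` exists (`Config.Deficient.exists_selected`) and forces `p` to have a link
leaving the subtree (`Config.Selected.not_closedAt`). After performing these swaps for all deficient
subtrees, a lowest uncovered node `w` is not deficient (`Config.exists_isolated`).
-/

namespace TreeAug

section Rooted

variable {V ι : Type*}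

/-! ### Weights of sets of links -/

open Classical in
/-- The total weight `x(P)` of the links with property `P`. -/
noncomputable def weight [Fintype ι] (x : ι → ℝ) (P : ι → Prop) : ℝ :=
  ∑ e, if P e then x e else 0

open Classical in
/-- The number of ends, among `p` and `q`, that lie in `Y`. -/
noncomputable def ends (Y : Finset V) (p q : V) : ℝ :=
  (if p ∈ Y then 1 else 0) + (if q ∈ Y then 1 else 0)

/-- In a tree order, the edge from `v` to its parent separates `p` from `q`: exactly one of them
is a descendant of `v`. -/
def Separates [LE V] (v p q : V) : Prop := ¬ (p ≤ v ↔ q ≤ v)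

/-- A leaf of the tree on the nodes `N`: a non-root node without proper descendants in `N`. -/
def IsLeaf [LE V] [OrderTop V] (N : Finset V) (v : V) : Prop :=
  v ∈ N ∧ v ≠ ⊤ ∧ ∀ u ∈ N, u ≤ v → u = v

section Weights

variable [Fintype ι]

theorem weight_nonneg {x : ι → ℝ} (hx : ∀ e, 0 ≤ x e) (P : ι → Prop) : 0 ≤ weight x P :=
  Finset.sum_nonneg fun e _ => by split_ifs <;> simp [hx]

theorem exists_of_weight_pos {x : ι → ℝ} {P : ι → Prop} (h : 0 < weight x P) : ∃ e, P e := by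
  by_contra! hP
  simp [weight, hP] at h

theorem weight_eq_zero {x : ι → ℝ} {P : ι → Prop} (h : ∀ e, ¬ P e) : weight x P = 0 := by
  simp [weight, h]

theorem weight_le_sum_weight {κ : Type*} {x : ι → ℝ} (hx : ∀ e, 0 ≤ x e) {A : Finset κ}
    {P : ι → Prop} {R : κ → ι → Prop} (h : ∀ e, P e → ∃ s ∈ A, R s e) :
    weight x P ≤ ∑ s ∈ A, weight x (R s) := by
  classical
  unfold weight
  rw [Finset.sum_comm]
  refine Finset.sum_le_sum fun e _ => ?_
  have hnn : ∀ s ∈ A, 0 ≤ if R s e then x e else 0 := fun s _ => by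
    split_ifs <;> simp [hx]
  by_cases hP : P e
  · obtain ⟨s, hs, hR⟩ := h e hP
    have := Finset.single_le_sum hnn hs
    rw [if_pos hR] at this
    rwa [if_pos hP]
  · rw [if_neg hP]
    exact Finset.sum_nonneg hnn

theorem ends_nonneg (Y : Finset V) (p q : V) : 0 ≤ ends Y p q := by
  unfold ends; positivity

open Classical in
/-- A linear inequality between weights and a sum of degrees follows from the inequality between the
contributions of each single link. -/
theorem weight_le_of_pointwise {x : ι → ℝ} (hx : ∀ e, 0 ≤ x e) {a b : ι → V} {Y : Finset V}
    {P₁ P₂ P₃ P₄ R : ι → Prop}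
    (h : ∀ e, (if P₁ e then (1 : ℝ) else 0) + (if P₂ e then 1 else 0) + (if P₃ e then 1 else 0)
      + (if P₄ e then 1 else 0) ≤ ends Y (a e) (b e) + (if R e then 1 else 0)) :
    weight x P₁ + weight x P₂ + weight x P₃ + weight x P₄
      ≤ ∑ e, x e * ends Y (a e) (b e) + weight x R := by
  unfold weight
  simp only [← Finset.sum_add_distrib]
  refine Finset.sum_le_sum fun e _ => ?_
  have := mul_le_mul_of_nonneg_left (h e) (hx e)
  simpa [mul_add] using this

end Weights

/-! ### Configurations and their credit -/

/-- A stage of the contraction process. The order on `V` is the descendant order of a rooted tree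
and does not change; the current tree, in which the tree edges above the nodes outside `N` have been
contracted, has the node set `N`, with the induced order. The ends of the links are nodes of the
current tree. Every leaf belongs to `Q` or is an end of a link of the matching `M`. -/
structure Config (V ι : Type*) [PartialOrder V] [OrderTop V] [Fintype ι] where
  /-- the LP weights of the links -/
  x : ι → ℝ
  /-- the nodes of the current tree -/
  N : Finset V
  /-- the first end of each link -/
  a : ι → V
  /-- the second end of each link -/
  b : ι → V
  /-- the nodes that hold one unit of credit: unmatched leaves and contracted subtrees -/
  Q : Finset V
  /-- a matching on the leaves outside `Q` -/
  M : Finset ι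
  x_nonneg : ∀ e, 0 ≤ x e
  chain : ∀ u v w : V, u ≤ v → u ≤ w → v ≤ w ∨ w ≤ v
  top_mem : ⊤ ∈ N
  a_mem : ∀ e, a e ∈ N
  b_mem : ∀ e, b e ∈ N
  cut : ∀ v ∈ N, v ≠ ⊤ → 1 ≤ weight x fun e => Separates v (a e) (b e)
  fork : ∀ u ∈ N, ∀ v ∈ N, ∀ w ∈ N, w ≠ ⊤ → u < w → v < w → ¬ u ≤ v → ¬ v ≤ u →
    2 ≤ weight x fun e =>
      Separates u (a e) (b e) ∨ Separates v (a e) (b e) ∨ Separates w (a e) (b e)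
  Q_sub : Q ⊆ N
  leaf_cases : ∀ v, IsLeaf N v → v ∈ Q ∨ ∃ e ∈ M, a e = v ∨ b e = v
  M_leaf : ∀ e ∈ M, IsLeaf N (a e) ∧ IsLeaf N (b e) ∧ a e ≠ b e ∧ a e ∉ Q ∧ b e ∉ Q
  M_disj : ∀ e ∈ M, ∀ f ∈ M, e ≠ f → a e ≠ a f ∧ a e ≠ b f ∧ b e ≠ a f ∧ b e ≠ b f
  /-- no link of `M` joins the only two leaves of a proper subtree, unless the subtree holds a unit
  of credit -/
  third : ∀ e ∈ M, ∀ v ∈ N, v ≠ ⊤ → a e ≤ v → b e ≤ v →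
    (∃ q ∈ Q, q ≤ v) ∨ ∃ f ∈ M, f ≠ e ∧ (a f ≤ v ∨ b f ≤ v)

namespace Config

variable [PartialOrder V] [OrderTop V] [Fintype ι] (c : Config V ι)

/-- The link `e` covers the edge above `v`. -/
def Crosses (e : ι) (v : V) : Prop := Separates v (c.a e) (c.b e)

/-- The link `e` joins `p` and `q`. -/
def Joins (e : ι) (p q : V) : Prop := (c.a e = p ∧ c.b e = q) ∨ (c.a e = q ∧ c.b e = p)

/-- The sum over the nodes in `Y` of the total weight of the links incident to them. -/
noncomputable def load (Y : Finset V) : ℝ := ∑ e, c.x e * ends Y (c.a e) (c.b e)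

open Classical in
/-- The nodes of the current subtree of `w`. -/
noncomputable def below (w : V) : Finset V := c.N.filter (· ≤ w)

open Classical in
/-- The nodes of the current subtree of `w` outside `Q`. -/
noncomputable def free (w : V) : Finset V := c.N.filter fun z => z ≤ w ∧ z ∉ c.Q

open Classical in
/-- The credit of a configuration: one unit for each node of `Q`, half a unit for each link of `M`,
and half the degree of each node outside `Q`. -/
noncomputable def potential : ℝ := c.Q.card + c.M.card / 2 + c.load (c.N \ c.Q) / 2

/-- All links at `l` stay in the subtree of `w`. -/
def ClosedAt (l w : V) : Prop := ∀ e, (c.a e = l → c.b e ≤ w) ∧ (c.b e = l → c.a e ≤ w)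

/-- No link of `M`, and no link at a leaf of `Q`, leaves the subtree of `w`. -/
def Isolated (w : V) : Prop :=
  (∀ e ∈ c.M, c.a e ≤ w ↔ c.b e ≤ w) ∧ ∀ q ∈ c.Q, IsLeaf c.N q → q ≤ w → c.ClosedAt q w

/-- The subtree of `w` is isolated, `e` is its only link of `M`, the leaf `u` is its only node in
`Q`, and the degrees of its other nodes sum up to less than `3`: these are the isolated proper
subtrees whose credit is too small to pay for their contraction. -/
structure Deficient (e : ι) (u w : V) : Prop where
  mem : w ∈ c.N
  ne_top : w ≠ ⊤
  isolated : c.Isolated w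
  link_mem : e ∈ c.M
  link_le : c.a e ≤ w
  link_unique : ∀ f ∈ c.M, c.a f ≤ w → f = e
  u_mem : u ∈ c.Q
  u_leaf : IsLeaf c.N u
  u_le : u ≤ w
  u_unique : ∀ q ∈ c.Q, q ≤ w → q = u
  load_lt : c.load (c.free w) < 3

/-- The link `f = qu` may replace the link `e = pq` of `M` in a deficient subtree with the
leaf `u`; then `p` becomes the unmatched leaf. Every subtree containing `q` and `u` must contain `p`,
so that `f` alone does not cut off a smaller subtree, and the last condition makes `p` have a link
that leaves the subtree, see `Selected.not_closedAt`. It does not mention the subtree, hence can be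
used for any two nested deficient subtrees with the same `e` and `u`. -/
structure Selected (e : ι) (u p q : V) (f : ι) : Prop where
  link : c.Joins e p q
  swap : c.Joins f q u
  join_le : ∀ s ∈ c.N, q ≤ s → u ≤ s → p ≤ s
  or_weight : (∃ s ∈ c.N, p ≤ s ∧ u ≤ s ∧ ¬ q ≤ s) ∨
    weight c.x (fun g => c.Joins g p u) ≤ weight c.x (fun g => c.Joins g q u)

variable {c}

theorem mem_free {w z : V} : z ∈ c.free w ↔ z ∈ c.N ∧ z ≤ w ∧ z ∉ c.Q := by simp [free]

theorem mem_below {w z : V} : z ∈ c.below w ↔ z ∈ c.N ∧ z ≤ w := by simp [below]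

theorem load_nonneg (Y : Finset V) : 0 ≤ c.load Y :=
  Finset.sum_nonneg fun e _ => mul_nonneg (c.x_nonneg e) (ends_nonneg ..)

theorem le_leaf_iff {l z : V} (hl : IsLeaf c.N l) (hz : z ∈ c.N) : z ≤ l ↔ z = l :=
  ⟨hl.2.2 z hz, fun h => h.le⟩

open Classical in
theorem weight_le_load {Y : Finset V} {P₁ P₂ P₃ P₄ R : ι → Prop}
    (h : ∀ e, (if P₁ e then (1 : ℝ) else 0) + (if P₂ e then 1 else 0) + (if P₃ e then 1 else 0)
      + (if P₄ e then 1 else 0) ≤ ends Y (c.a e) (c.b e) + (if R e then 1 else 0)) :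
    weight c.x P₁ + weight c.x P₂ + weight c.x P₃ + weight c.x P₄
      ≤ c.load Y + weight c.x R :=
  weight_le_of_pointwise c.x_nonneg h

open Classical in
theorem weight_le_load₃ {Y : Finset V} {P₁ P₂ P₃ : ι → Prop}
    (h : ∀ e, (if P₁ e then (1 : ℝ) else 0) + (if P₂ e then 1 else 0) + (if P₃ e then 1 else 0)
      ≤ ends Y (c.a e) (c.b e)) :
    weight c.x P₁ + weight c.x P₂ + weight c.x P₃ ≤ c.load Y := by
  have := weight_le_load (c := c) (Y := Y) (P₁ := P₁) (P₂ := P₂) (P₃ := P₃)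
    (P₄ := fun _ => False) (R := fun _ => False) (fun e => by simpa using h e)
  simpa [weight] using this

open Classical in
theorem weight_le_load₂ {Y : Finset V} {P₁ P₂ : ι → Prop}
    (h : ∀ e, (if P₁ e then (1 : ℝ) else 0) + (if P₂ e then 1 else 0)
      ≤ ends Y (c.a e) (c.b e)) :
    weight c.x P₁ + weight c.x P₂ ≤ c.load Y := by
  have := weight_le_load₃ (c := c) (Y := Y) (P₁ := P₁) (P₂ := P₂)
    (P₃ := fun _ => False) (fun e => by simpa using h e)
  simpa [weight] using this

theorem one_le_weight_crosses {v : V} (hv : v ∈ c.N) (h : v ≠ ⊤) :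
    1 ≤ weight c.x fun e => c.Crosses e v := c.cut v hv h

theorem exists_crosses {v : V} (hv : v ∈ c.N) (h : v ≠ ⊤) : ∃ e, c.Crosses e v :=
  exists_of_weight_pos (lt_of_lt_of_le one_pos (c.one_le_weight_crosses hv h))

theorem crosses_leaf {l : V} (hl : IsLeaf c.N l) (e : ι) :
    c.Crosses e l ↔ ¬ (c.a e = l ↔ c.b e = l) := by
  rw [Crosses, Separates, le_leaf_iff hl (c.a_mem e), le_leaf_iff hl (c.b_mem e)]

/-- Some link at a leaf `l` covers all tree edges above `l` that are covered by links at `l`, since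
for each link these edges form an initial segment of the path from `l` to the root. -/
theorem exists_up {l : V} (hl : IsLeaf c.N l) :
    ∃ e, (c.a e = l ∨ c.b e = l) ∧ ∀ v ∈ c.N, l ≤ v → ¬ c.Crosses e v → c.ClosedAt l v := by
  classical
  obtain ⟨e₀, he₀⟩ := c.exists_crosses hl.1 hl.2.1
  have hne : (Finset.univ.filter fun e => c.a e = l ∨ c.b e = l).Nonempty :=
    ⟨e₀, by rw [crosses_leaf hl] at he₀; simp; tauto⟩
  obtain ⟨e, he, hmax⟩ := Finset.exists_max_image _
    (fun e => (c.N.filter fun v => l ≤ v ∧ c.Crosses e v).card) hne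
  simp only [Finset.mem_filter, Finset.mem_univ, true_and] at he hmax
  refine ⟨e, he, fun v hv hlv hev => ?_⟩
  have key : ∀ f, (c.a f = l ∨ c.b f = l) → ¬ c.Crosses f v := by
    intro f hf hfv
    refine absurd (hmax f hf) (not_le.2 (Finset.card_lt_card ?_))
    rw [Finset.ssubset_iff_of_subset]
    · exact ⟨v, by simp [hv, hlv, hfv], by simp [hev]⟩
    · intro v' hv'
      simp only [Finset.mem_filter] at hv' ⊢
      obtain ⟨h1, h2, h3⟩ := hv'
      refine ⟨h1, h2, ?_⟩
      have hle : v' ≤ v := by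
        rcases c.chain l v v' hlv h2 with h | h
        · exfalso
          apply h3
          unfold Crosses Separates at hev
          rcases he with he | he
          · rw [he] at hev ⊢
            exact iff_of_true h2 (le_trans (by tauto) h)
          · rw [he] at hev ⊢
            exact iff_of_true (le_trans (by tauto) h) h2
        · exact h
      unfold Crosses Separates at hfv ⊢
      rcases hf with hf | hf
      · rw [hf] at hfv ⊢
        exact fun h => hfv (iff_of_true hlv ((h.1 h2).trans hle))
      · rw [hf] at hfv ⊢
        exact fun h => hfv (iff_of_true ((h.2 h2).trans hle) hlv)
  intro f
  constructor
  · intro h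
    have := key f (Or.inl h)
    unfold Crosses Separates at this
    rw [h] at this; tauto
  · intro h
    have := key f (Or.inr h)
    unfold Crosses Separates at this
    rw [h] at this; tauto

/-! ### Deficient subtrees -/

theorem Deficient.mem_or {e : ι} {u w : V} (h : c.Deficient e u w) {z : V} (hz : z ∈ c.N)
    (hzw : z ≤ w) : z ∈ c.free w ∨ z = u := by
  by_cases hQ : z ∈ c.Q
  · exact Or.inr (h.u_unique z hQ hzw)
  · exact Or.inl (mem_free.2 ⟨hz, hzw, hQ⟩)

theorem Deficient.closedAt {e : ι} {u w : V} (h : c.Deficient e u w) : c.ClosedAt u w :=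
  h.isolated.2 u h.u_mem h.u_leaf h.u_le

/-- If the links at the unmatched leaf `p` stayed in the subtree, its degrees would sum up to at
least `3`. If `p` and `u` lie below some `s` with `q ≰ s`, each link has at least as many ends outside
`Q` as it is counted in the fork constraint of `q`, `s`, `w` and the cut constraint of `p`. Otherwise
the cut constraint of `p` is used twice and that of `w` once, and the links `pu`, which are counted
once too often, are made up for by the links `qu`, which are not counted. -/
theorem Selected.not_closedAt {e f : ι} {u p q w : V} (hd : c.Deficient e u w)
    (hs : c.Selected e u p q f) : ¬ c.ClosedAt p w := by
  classical
  intro hp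
  have hu := hd.closedAt
  have hM := c.M_leaf e hd.link_mem
  have hiso := hd.isolated.1 e hd.link_mem
  obtain ⟨hlp, hlq, hpq, hpQ, hqQ, hpw, hqw⟩ : IsLeaf c.N p ∧ IsLeaf c.N q ∧ p ≠ q ∧ p ∉ c.Q ∧
      q ∉ c.Q ∧ p ≤ w ∧ q ≤ w := by
    have hle := hd.link_le
    rcases hs.link with ⟨rfl, rfl⟩ | ⟨rfl, rfl⟩
    · tauto
    · have := hM.2.2.1.symm
      tauto
  have hlu := hd.u_leaf
  have huw := hd.u_le
  have hup : u ≠ p := fun h => hpQ (h ▸ hd.u_mem)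
  have huq : u ≠ q := fun h => hqQ (h ▸ hd.u_mem)
  have hpF : p ∈ c.free w := mem_free.2 ⟨hlp.1, hpw, hpQ⟩
  have hqF : q ∈ c.free w := mem_free.2 ⟨hlq.1, hqw, hqQ⟩
  have huF : u ∉ c.free w := fun h => (mem_free.1 h).2.2 hd.u_mem
  have hF : ∀ z ∈ c.N, z ≤ w → z ∈ c.free w ∨ z = u := fun z hz => hd.mem_or hz
  refine absurd hd.load_lt (not_lt.2 ?_)
  rcases hs.or_weight with ⟨s, hsN, hps, hus, hqs⟩ | hle
  · have hsw : s < w := by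
      rcases c.chain p s w hps hpw with h | h
      · exact lt_of_le_of_ne h fun h => hqs (h ▸ hqw)
      · exact absurd (hqw.trans h) hqs
    have h2 := c.fork q hlq.1 s hsN w hd.mem hd.ne_top
      (lt_of_le_of_ne hqw fun h => by
        subst h; exact hpq (hlq.2.2 p hlp.1 hpw)) hsw hqs
      (fun h => huq (hlq.2.2 u hlu.1 (hus.trans h)))
    have h1 := c.one_le_weight_crosses hlp.1 hlp.2.1
    have h3 := weight_le_load₂ (c := c) (Y := c.free w)
      (P₁ := fun e => Separates q (c.a e) (c.b e) ∨ Separates s (c.a e) (c.b e) ∨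
        Separates w (c.a e) (c.b e)) (P₂ := fun e => c.Crosses e p) (by
      intro g
      have ha := hF _ (c.a_mem g)
      have hb := hF _ (c.b_mem g)
      have haq := le_leaf_iff hlq (c.a_mem g)
      have hbq := le_leaf_iff hlq (c.b_mem g)
      have hpg := hp g
      have hug := hu g
      have hsw' : ∀ z, z ≤ s → z ≤ w := fun z h => h.trans hsw.le
      have has := hsw' (c.a g)
      have hbs := hsw' (c.b g)
      unfold ends
      simp only [crosses_leaf hlp, Separates, haq, hbq]
      clear hs hd h2 h1 hM hiso hF hsw hp hu hsw'
      grind)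
    linarith
  · have h1 := c.one_le_weight_crosses hlp.1 hlp.2.1
    have h2 := c.one_le_weight_crosses hd.mem hd.ne_top
    have h3 := weight_le_load (c := c) (Y := c.free w) (P₁ := fun e => c.Crosses e p)
      (P₂ := fun e => c.Crosses e p) (P₃ := fun e => c.Crosses e w)
      (P₄ := fun e => c.Joins e q u) (R := fun e => c.Joins e p u) (by
        intro g
        have ha := hF _ (c.a_mem g)
        have hb := hF _ (c.b_mem g)
        have hpg := hp g
        have hug := hu g
        have hap := le_leaf_iff hlp (c.a_mem g)
        have hbp := le_leaf_iff hlp (c.b_mem g)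
        unfold ends
        simp only [Crosses, Joins, Separates, hap, hbp]
        clear hs hd h2 h1 hM hiso hF hp hu hle
        grind)
    linarith

/-- In a deficient subtree with the `M`-link `e` and the leaf `u ∈ Q`, let `p` be the end of `e` that
lies below a common ancestor with `u` not shared by the other end, if there is one, and otherwise
the end with less weight towards `u`. If no link joined the other end `q` to `u`, then the degrees
would sum up to at least `3`. -/
theorem Deficient.exists_selected {e : ι} {u w : V} (hd : c.Deficient e u w) :
    ∃ p q f, c.Selected e u p q f := by
  classical
  have hM := c.M_leaf e hd.link_mem
  have hu := hd.closedAt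
  have hlu := hd.u_leaf
  have hF : ∀ z ∈ c.N, z ≤ w → z ∈ c.free w ∨ z = u := fun z hz => hd.mem_or hz
  have huF : u ∉ c.free w := fun h => (mem_free.1 h).2.2 hd.u_mem
  obtain ⟨p, q, hj, hpq⟩ : ∃ p q, c.Joins e p q ∧
      ((∃ s ∈ c.N, p ≤ s ∧ u ≤ s ∧ ¬ q ≤ s) ∨ ((∀ s ∈ c.N, q ≤ s → u ≤ s → p ≤ s) ∧
        weight c.x (fun g => c.Joins g p u) ≤ weight c.x (fun g => c.Joins g q u))) := by
    by_cases h1 : ∃ s ∈ c.N, c.a e ≤ s ∧ u ≤ s ∧ ¬ c.b e ≤ s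
    · exact ⟨c.a e, c.b e, Or.inl ⟨rfl, rfl⟩, Or.inl h1⟩
    by_cases h2 : ∃ s ∈ c.N, c.b e ≤ s ∧ u ≤ s ∧ ¬ c.a e ≤ s
    · exact ⟨c.b e, c.a e, Or.inr ⟨rfl, rfl⟩, Or.inl h2⟩
    push Not at h1 h2
    rcases le_total (weight c.x (fun g => c.Joins g (c.a e) u))
      (weight c.x (fun g => c.Joins g (c.b e) u)) with h | h
    · exact ⟨c.a e, c.b e, Or.inl ⟨rfl, rfl⟩, Or.inr ⟨fun s hs x y => h2 s hs x y, h⟩⟩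
    · exact ⟨c.b e, c.a e, Or.inr ⟨rfl, rfl⟩, Or.inr ⟨fun s hs x y => h1 s hs x y, h⟩⟩
  obtain ⟨hlp, hlq, hne, hpQ, hqQ, hpw, hqw⟩ : IsLeaf c.N p ∧ IsLeaf c.N q ∧ p ≠ q ∧ p ∉ c.Q ∧
      q ∉ c.Q ∧ p ≤ w ∧ q ≤ w := by
    have hle := hd.link_le
    have hiso := hd.isolated.1 e hd.link_mem
    rcases hj with ⟨rfl, rfl⟩ | ⟨rfl, rfl⟩
    · tauto
    · have := hM.2.2.1.symm
      tauto
  have huw := hd.u_le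
  have hup : u ≠ p := fun h => hpQ (h ▸ hd.u_mem)
  have huq : u ≠ q := fun h => hqQ (h ▸ hd.u_mem)
  have hpF : p ∈ c.free w := mem_free.2 ⟨hlp.1, hpw, hpQ⟩
  have hqF : q ∈ c.free w := mem_free.2 ⟨hlq.1, hqw, hqQ⟩
  have hf : ∃ f, c.Joins f q u := by
    by_contra! hno
    refine absurd hd.load_lt (not_lt.2 ?_)
    have h1 := c.one_le_weight_crosses hlq.1 hlq.2.1
    rcases hpq with ⟨s, hsN, hps, hus, hqs⟩ | ⟨-, hle⟩
    · have hsw : s ≤ w := by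
        rcases c.chain p s w hps hpw with h | h
        · exact h
        · exact absurd (hqw.trans h) hqs
      have hs : s ≠ ⊤ := fun h => hqs (h ▸ le_top)
      have h2 := c.fork p hlp.1 u hlu.1 s hsN hs
        (lt_of_le_of_ne hps fun h => by subst h; exact hup (hlp.2.2 u hlu.1 hus))
        (lt_of_le_of_ne hus fun h => by subst h; exact hup (hlu.2.2 p hlp.1 hps).symm)
        (fun h => hup (hlu.2.2 p hlp.1 h).symm) (fun h => hup (hlp.2.2 u hlu.1 h))
      have h3 := weight_le_load₂ (c := c) (Y := c.free w)
        (P₁ := fun e => Separates p (c.a e) (c.b e) ∨ Separates u (c.a e) (c.b e) ∨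
          Separates s (c.a e) (c.b e)) (P₂ := fun e => c.Crosses e q) (by
        intro g
        have ha := hF _ (c.a_mem g)
        have hb := hF _ (c.b_mem g)
        have hap := le_leaf_iff hlp (c.a_mem g)
        have hbp := le_leaf_iff hlp (c.b_mem g)
        have hau := le_leaf_iff hlu (c.a_mem g)
        have hbu := le_leaf_iff hlu (c.b_mem g)
        have hug := hu g
        have hng := hno g
        have hsw' : ∀ z, z ≤ s → z ≤ w := fun z h => h.trans hsw
        have has := hsw' (c.a g)
        have hbs := hsw' (c.b g)
        unfold ends
        unfold Joins at hng
        simp only [crosses_leaf hlq, Separates, hap, hbp, hau, hbu]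
        clear hd h2 h1 hM hF hsw hu hsw' hno
        grind)
      linarith
    · have h0 : weight c.x (fun g => c.Joins g q u) = 0 := weight_eq_zero hno
      have h2 := c.one_le_weight_crosses hlp.1 hlp.2.1
      have h3 := c.one_le_weight_crosses hlu.1 hlu.2.1
      have h4 := weight_le_load (c := c) (Y := c.free w) (P₁ := fun e => c.Crosses e p)
        (P₂ := fun e => c.Crosses e q) (P₃ := fun e => c.Crosses e u)
        (P₄ := fun e => False) (R := fun e => c.Joins e p u) (by
          intro g
          have ha := hF _ (c.a_mem g)
          have hb := hF _ (c.b_mem g)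
          have hug := hu g
          have hng := hno g
          unfold ends
          unfold Joins at hng
          simp only [crosses_leaf hlp, crosses_leaf hlq, crosses_leaf hlu, Joins]
          clear hd h2 h1 h3 hM hF hu hno
          grind)
      have h5 := weight_nonneg c.x_nonneg fun _ => False
      linarith
  obtain ⟨f, hf⟩ := hf
  refine ⟨p, q, f, hj, hf, ?_, ?_⟩
  · intro s' hs' hqs' hus'
    rcases hpq with ⟨s, hsN, hps, hus, hqs⟩ | ⟨h, -⟩
    · rcases c.chain u s s' hus hus' with h | h
      · exact hps.trans h
      · exact absurd (hqs'.trans h) hqs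
    · exact h s' hs' hqs' hus'
  · rcases hpq with h | ⟨-, h⟩
    · exact Or.inl h
    · exact Or.inr h

/-! ### Contracting part of the tree -/

/-- Each node has a least ancestor in `N'`. -/
theorem exists_projection (c : Config V ι) (N' : Finset V) (h : ⊤ ∈ N') :
    ∃ π : V → V, ∀ p, π p ∈ N' ∧ ∀ v ∈ N', π p ≤ v ↔ p ≤ v := by
  classical
  have : ∀ p : V, ∃ m, m ∈ N' ∧ ∀ v ∈ N', m ≤ v ↔ p ≤ v := by
    intro p
    obtain ⟨m, hm⟩ := (N'.filter (p ≤ ·)).exists_minimal ⟨⊤, by simp [h]⟩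
    have hm1 := hm.1
    simp only [Finset.mem_filter] at hm1
    refine ⟨m, hm1.1, fun v hv => ⟨hm1.2.trans, fun hpv => ?_⟩⟩
    rcases c.chain p m v hm1.2 hpv with h | h
    · exact h
    · exact hm.2 (by simp [hv, hpv]) h
  choose π hπ using this
  exact ⟨π, hπ⟩

theorem load_union {A B : Finset V} [DecidableEq V] (h : Disjoint A B) :
    c.load (A ∪ B) = c.load A + c.load B := by
  classical
  unfold load
  rw [← Finset.sum_add_distrib]
  refine Finset.sum_congr rfl fun e _ => ?_
  rw [← mul_add]
  congr 1
  have h1 : ∀ z, z ∈ A → z ∉ B := fun z hz => Finset.disjoint_left.1 h hz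
  have ha := h1 (c.a e)
  have hb := h1 (c.b e)
  simp only [ends, Finset.mem_union]
  by_cases h2 : c.a e ∈ A <;> by_cases h3 : c.a e ∈ B <;> by_cases h4 : c.b e ∈ A <;>
    by_cases h5 : c.b e ∈ B <;> simp_all

open Classical in
/-- The contraction of the tree edges above the nodes of `S`, all of which merge into the single
node `t`. If the credit of the merged nodes pays for the links of `J` and for the unit of credit at
the new node, then the total credit decreases by at least the number of links bought. -/
theorem exists_contract (c : Config V ι) {S : Finset V} {t : V} {J : Finset ι} (hSN : S ⊆ c.N)
    (hne : S.Nonempty) (htN : t ∈ c.N) (htS : t ∉ S) (hSt : ∀ s ∈ S, s ≤ t)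
    (hup : ∀ s ∈ S, ∀ v ∈ c.N, v ∉ S → s ≤ v → t ≤ v)
    (hM : ∀ e ∈ c.M, c.a e ∈ S ↔ c.b e ∈ S)
    (hcost : (J.card : ℝ) + 1 ≤ (c.Q ∩ insert t S).card
      + ((c.M.filter fun e => c.a e ∈ S).card : ℝ) / 2 + c.load (insert t S \ c.Q) / 2) :
    ∃ c' : Config V ι, c'.N = c.N \ S ∧
      (∀ e, ∀ v ∈ c'.N, c'.Crosses e v ↔ c.Crosses e v) ∧
      c'.potential + J.card ≤ c.potential := by
  have htop : ⊤ ∉ S := fun h => htS (top_unique (hSt _ h) ▸ h)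
  have htopN : ⊤ ∈ c.N \ S := by simp [c.top_mem, htop]
  obtain ⟨π, hπ⟩ := c.exists_projection (c.N \ S) htopN
  have hπid : ∀ p ∈ c.N, p ∉ S → π p = p := fun p hp hpS => by
    have hp' : p ∈ c.N \ S := by simp [hp, hpS]
    exact le_antisymm (((hπ p).2 p hp').2 le_rfl) (((hπ p).2 _ (hπ p).1).1 le_rfl)
  have hπS : ∀ p ∈ S, π p = t := fun p hp => by
    have h1 := Finset.mem_sdiff.1 (hπ p).1
    exact le_antisymm (((hπ p).2 t (by simp [htN, htS])).2 (hSt p hp))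
      (hup p hp _ h1.1 h1.2 (((hπ p).2 _ (hπ p).1).1 le_rfl))
  have hsep : ∀ v ∈ c.N \ S, ∀ e, Separates v (π (c.a e)) (π (c.b e)) ↔
      Separates v (c.a e) (c.b e) := fun v hv e => by
    simp only [Separates, (hπ _).2 v hv]
  have htleaf : ¬ IsLeaf c.N t := fun h => by
    obtain ⟨s, hs⟩ := hne
    exact htS (h.2.2 s (hSN hs) (hSt s hs) ▸ hs)
  have hleaf : ∀ v, IsLeaf c.N v → v ∉ S → IsLeaf (c.N \ S) v := fun v hv hvS =>
    ⟨by simp [hv.1, hvS], hv.2.1, fun u hu => hv.2.2 u (Finset.mem_sdiff.1 hu).1⟩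
  have hcases : ∀ z ∈ c.N, π z ∈ (c.N \ S) \ insert t (c.Q \ S) ↔
      z ∈ (c.N \ c.Q) \ insert t S := fun z hz => by
    by_cases hzS : z ∈ S
    · simp [hπS z hzS, hzS]
    · rw [hπid z hz hzS]; simp [hzS, hz]; tauto
  have hnew : ∀ q ∈ c.Q, ∀ v ∈ c.N \ S, q ≤ v → ∃ q ∈ insert t (c.Q \ S), q ≤ v := by
    intro q hq v hv hqv
    by_cases hqS : q ∈ S
    · have := Finset.mem_sdiff.1 hv
      exact ⟨t, by simp, hup q hqS v this.1 this.2 hqv⟩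
    · exact ⟨q, by simp [hq, hqS], hqv⟩
  let c' : Config V ι :=
    { x := c.x
      N := c.N \ S
      a := fun e => π (c.a e)
      b := fun e => π (c.b e)
      Q := insert t (c.Q \ S)
      M := c.M.filter fun e => c.a e ∉ S
      x_nonneg := c.x_nonneg
      chain := c.chain
      top_mem := htopN
      a_mem := fun e => (hπ _).1
      b_mem := fun e => (hπ _).1
      cut := fun v hv hv' => by
        simp only [hsep v hv]
        exact c.cut v (Finset.mem_sdiff.1 hv).1 hv'
      fork := fun u hu v hv w hw h1 h2 h3 h4 h5 => by
        simp only [hsep u hu, hsep v hv, hsep w hw]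
        exact c.fork u (Finset.mem_sdiff.1 hu).1 v (Finset.mem_sdiff.1 hv).1 w
          (Finset.mem_sdiff.1 hw).1 h1 h2 h3 h4 h5
      Q_sub := by
        intro q hq
        rcases Finset.mem_insert.1 hq with rfl | hq
        · simp [htN, htS]
        · have := Finset.mem_sdiff.1 hq
          simp [c.Q_sub this.1, this.2]
      leaf_cases := fun v hv => by
        by_cases hvt : v = t
        · left; simp [hvt]
        have hvN := Finset.mem_sdiff.1 hv.1
        have hvl : IsLeaf c.N v := by
          refine ⟨hvN.1, hv.2.1, fun u hu huv => ?_⟩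
          by_cases huS : u ∈ S
          · exact absurd (hv.2.2 t (by simp [htN, htS]) (hup u huS v hvN.1 hvN.2 huv)).symm hvt
          · exact hv.2.2 u (by simp [hu, huS]) huv
        rcases c.leaf_cases v hvl with h | ⟨e, he, h⟩
        · left; simp [h, hvN.2]
        · right
          have hS : c.a e ∉ S := by
            rcases h with h | h
            · rw [h]; exact hvN.2
            · rw [hM e he, h]; exact hvN.2
          refine ⟨e, by simp [he, hS], ?_⟩
          rcases h with h | h
          · left; rw [h]; exact hπid v hvN.1 hvN.2
          · right; rw [h]; exact hπid v hvN.1 hvN.2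
      M_leaf := fun e he => by
        obtain ⟨he, heS⟩ := Finset.mem_filter.1 he
        have heS' : c.b e ∉ S := by rwa [← hM e he]
        obtain ⟨h1, h2, h3, h4, h5⟩ := c.M_leaf e he
        rw [hπid _ h1.1 heS, hπid _ h2.1 heS']
        refine ⟨hleaf _ h1 heS, hleaf _ h2 heS', h3, ?_, ?_⟩
        · simp only [Finset.mem_insert, Finset.mem_sdiff, not_or]
          exact ⟨fun h => htleaf (h ▸ h1), fun h => h4 h.1⟩
        · simp only [Finset.mem_insert, Finset.mem_sdiff, not_or]
          exact ⟨fun h => htleaf (h ▸ h2), fun h => h5 h.1⟩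
      M_disj := fun e he f hf hef => by
        obtain ⟨he, heS⟩ := Finset.mem_filter.1 he
        obtain ⟨hf, hfS⟩ := Finset.mem_filter.1 hf
        rw [hπid _ (c.a_mem e) heS, hπid _ (c.a_mem f) hfS, hπid _ (c.b_mem e) (by rwa [← hM e he]),
          hπid _ (c.b_mem f) (by rwa [← hM f hf])]
        exact c.M_disj e he f hf hef
      third := fun e he v hv hvt h1 h2 => by
        obtain ⟨he, heS⟩ := Finset.mem_filter.1 he
        have hv' := Finset.mem_sdiff.1 hv
        rw [(hπ _).2 v hv] at h1 h2
        rcases c.third e he v hv'.1 hvt h1 h2 with ⟨q, hq, hqv⟩ | ⟨f, hf, hfe, hfv⟩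
        · exact Or.inl (hnew q hq v hv hqv)
        · by_cases hfS : c.a f ∈ S
          · left
            refine ⟨t, by simp, ?_⟩
            rcases hfv with h | h
            · exact hup _ hfS v hv'.1 hv'.2 h
            · exact hup _ ((hM f hf).1 hfS) v hv'.1 hv'.2 h
          · right
            refine ⟨f, by simp [hf, hfS], hfe, ?_⟩
            rwa [(hπ _).2 v hv, (hπ _).2 v hv] }
  refine ⟨c', rfl, fun e v hv => hsep v hv e, ?_⟩
  have hload : c'.load (c'.N \ c'.Q) = c.load ((c.N \ c.Q) \ insert t S) := by
    unfold load ends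
    refine Finset.sum_congr rfl fun e _ => ?_
    have ha := hcases _ (c.a_mem e)
    have hb := hcases _ (c.b_mem e)
    simp only [c', ha, hb]
  have hload' : c.load (c.N \ c.Q) =
      c.load (insert t S \ c.Q) + c.load ((c.N \ c.Q) \ insert t S) := by
    rw [← load_union]
    · congr 1
      ext z
      have : z ∈ S → z ∈ c.N := fun h => hSN h
      have : z = t → z ∈ c.N := fun h => h ▸ htN
      simp only [Finset.mem_sdiff, Finset.mem_union, Finset.mem_insert]
      tauto
    · rw [Finset.disjoint_left]
      intro z hz hz'
      simp only [Finset.mem_sdiff] at hz hz'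
      exact hz'.2 hz.1
  have hQ : (c'.Q.card : ℝ) ≤ (c.Q \ insert t S).card + 1 := by
    have : c'.Q = insert t (c.Q \ insert t S) := by
      ext z; simp [c']; tauto
    rw [this]
    exact_mod_cast Finset.card_insert_le _ _
  have hQ' : (c.Q.card : ℝ) = (c.Q ∩ insert t S).card + (c.Q \ insert t S).card := by
    exact_mod_cast (Finset.card_inter_add_card_sdiff c.Q (insert t S)).symm
  have hM' : (c.M.card : ℝ) = (c.M.filter fun e => c.a e ∈ S).card + c'.M.card := by
    exact_mod_cast (Finset.card_filter_add_card_filter_not (s := c.M) (fun e => c.a e ∈ S)).symm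
  unfold potential
  rw [hload, hload', hQ', hM']
  linarith

/-! ### The contraction process -/

theorem load_mono {A B : Finset V} (h : A ⊆ B) : c.load A ≤ c.load B := by
  classical
  have := load_union (c := c) (Finset.disjoint_sdiff (s := A) (t := B))
  rw [Finset.union_sdiff_of_subset h] at this
  linarith [c.load_nonneg (B \ A)]

theorem one_le_load_singleton {l : V} (hl : IsLeaf c.N l) : 1 ≤ c.load {l} := by
  classical
  have h1 := c.one_le_weight_crosses hl.1 hl.2.1
  have h2 := weight_le_load₂ (c := c) (Y := {l}) (P₁ := fun e => c.Crosses e l)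
    (P₂ := fun _ => False) (fun g => by
      simp only [crosses_leaf hl, ends, Finset.mem_singleton]
      grind)
  have h3 := weight_nonneg c.x_nonneg fun _ => False
  linarith

theorem card_le_load {Y : Finset V} (h : ∀ l ∈ Y, IsLeaf c.N l) : (Y.card : ℝ) ≤ c.load Y := by
  classical
  induction Y using Finset.induction_on with
  | empty => simpa using c.load_nonneg ∅
  | insert l Y hl ih =>
    rw [Finset.card_insert_of_notMem hl, Finset.insert_eq,
      load_union (Finset.disjoint_singleton_left.2 hl)]
    push_cast
    have h1 := ih fun z hz => h z (Finset.mem_insert_of_mem hz)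
    have h2 := one_le_load_singleton (h l (Finset.mem_insert_self ..))
    linarith

open Classical in
theorem card_ends {M' : Finset ι} (hM' : M' ⊆ c.M) :
    (M'.image c.a ∪ M'.image c.b).card = 2 * M'.card := by
  have ha : (M'.image c.a).card = M'.card := by
    refine Finset.card_image_of_injOn fun e he f hf hef => ?_
    by_contra hne
    exact (c.M_disj e (hM' he) f (hM' hf) hne).1 hef
  have hb : (M'.image c.b).card = M'.card := by
    refine Finset.card_image_of_injOn fun e he f hf hef => ?_
    by_contra hne
    exact (c.M_disj e (hM' he) f (hM' hf) hne).2.2.2 hef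
  have hd : Disjoint (M'.image c.a) (M'.image c.b) := by
    rw [Finset.disjoint_left]
    intro z hz hz'
    obtain ⟨e, he, rfl⟩ := Finset.mem_image.1 hz
    obtain ⟨f, hf, hfe⟩ := Finset.mem_image.1 hz'
    by_cases hne : e = f
    · subst hne
      exact (c.M_leaf e (hM' he)).2.2.1 hfe.symm
    · exact (c.M_disj e (hM' he) f (hM' hf) hne).2.1 hfe.symm
  rw [Finset.card_union_of_disjoint hd, ha, hb, two_mul]

open Classical in
theorem isLeaf_of_mem_ends {M' : Finset ι} (hM' : M' ⊆ c.M) {l : V}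
    (hl : l ∈ M'.image c.a ∪ M'.image c.b) : IsLeaf c.N l ∧ l ∉ c.Q := by
  rcases Finset.mem_union.1 hl with hl | hl <;> obtain ⟨e, he, rfl⟩ := Finset.mem_image.1 hl <;>
    have := c.M_leaf e (hM' he) <;> tauto

theorem two_mul_card_le_load {M' : Finset ι} {Y : Finset V} (hM' : M' ⊆ c.M)
    (h : ∀ e ∈ M', c.a e ∈ Y ∧ c.b e ∈ Y) : 2 * (M'.card : ℝ) ≤ c.load Y := by
  classical
  have hcard : ((M'.image c.a ∪ M'.image c.b).card : ℝ) = 2 * M'.card := by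
    exact_mod_cast card_ends hM'
  rw [← hcard]
  refine (card_le_load fun l hl => (isLeaf_of_mem_ends hM' hl).1).trans (load_mono ?_)
  intro l hl
  rcases Finset.mem_union.1 hl with hl | hl <;> obtain ⟨e, he, rfl⟩ := Finset.mem_image.1 hl
  · exact (h e he).1
  · exact (h e he).2

theorem exists_leaf_le {w : V} (hw : w ∈ c.N) (hwt : w ≠ ⊤) : ∃ l, IsLeaf c.N l ∧ l ≤ w := by
  classical
  obtain ⟨l, hl⟩ := (c.below w).exists_minimal ⟨w, mem_below.2 ⟨hw, le_rfl⟩⟩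
  have h1 := mem_below.1 hl.1
  refine ⟨l, ⟨h1.1, fun h => hwt (top_unique (h ▸ h1.2)), fun u hu hul => ?_⟩, h1.2⟩
  exact le_antisymm hul (hl.2 (mem_below.2 ⟨hu, hul.trans h1.2⟩) hul)

open Classical in
/-- An isolated proper subtree that is not deficient pays for one link for each leaf in `Q`, one for
each link of `M`, and a unit of credit for the contracted node, provided that no link joins two
nodes of `Q`. With `m` links of `M` and only leaves in `Q`, this needs degrees of the other nodes that
sum up to at least `m + 2`. The ends of `M` contribute `2 m`, which suffices if `m ≥ 2`; if `m ≤ 1`,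
the links at the leaves in `Q` and the links leaving the subtree have distinct ends outside `Q`. -/
theorem Isolated.card_add_one_le {w : V} (hw : w ∈ c.N) (hwt : w ≠ ⊤) (hiso : c.Isolated w)
    (hQQ : ∀ e, c.a e ∈ c.Q → c.b e ∈ c.Q → c.a e = c.b e)
    (hnd : ∀ e u, ¬ c.Deficient e u w) :
    ((c.Q.filter fun q => IsLeaf c.N q ∧ q ≤ w).card : ℝ)
      + (c.M.filter fun e => c.a e ≤ w).card + 1 ≤
    (c.Q.filter fun q => q ≤ w).card + ((c.M.filter fun e => c.a e ≤ w).card : ℝ) / 2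
      + c.load (c.free w) / 2 := by
  have hsub : (c.Q.filter fun q => IsLeaf c.N q ∧ q ≤ w) ⊆ c.Q.filter fun q => q ≤ w := by
    intro q; simp +contextual
  have hload : 2 * ((c.M.filter fun e => c.a e ≤ w).card : ℝ) ≤ c.load (c.free w) := by
    refine two_mul_card_le_load (Finset.filter_subset ..) fun e he => ?_
    obtain ⟨he, hle⟩ := Finset.mem_filter.1 he
    have h := c.M_leaf e he
    exact ⟨mem_free.2 ⟨h.1.1, hle, h.2.2.2.1⟩,
      mem_free.2 ⟨h.2.1.1, (hiso.1 e he).1 hle, h.2.2.2.2⟩⟩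
  rcases (Finset.card_le_card hsub).lt_or_eq with hlt | heq
  · have : ((c.Q.filter fun q => IsLeaf c.N q ∧ q ≤ w).card : ℝ) + 1 ≤
        (c.Q.filter fun q => q ≤ w).card := by exact_mod_cast hlt
    linarith
  have hQl : ∀ q ∈ c.Q, q ≤ w → IsLeaf c.N q := fun q hq hqw => by
    have : q ∈ c.Q.filter fun q => IsLeaf c.N q ∧ q ≤ w := by
      rw [Finset.eq_of_subset_of_card_le hsub heq.ge]; simp [hq, hqw]
    simp only [Finset.mem_filter] at this
    exact this.2.1
  rw [heq]
  have hF : ∀ z ∈ c.N, z ≤ w → z ∈ c.free w ∨ z ∈ c.Q := fun z hz hzw => by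
    by_cases hzQ : z ∈ c.Q
    · exact Or.inr hzQ
    · exact Or.inl (mem_free.2 ⟨hz, hzw, hzQ⟩)
  have hFQ : ∀ z, z ∈ c.free w → z ∉ c.Q ∧ z ≤ w := fun z hz =>
    ⟨(mem_free.1 hz).2.2, (mem_free.1 hz).2.1⟩
  have hcl : ∀ q ∈ c.Q, q ≤ w → c.ClosedAt q w := fun q hq hqw => hiso.2 q hq (hQl q hq hqw) hqw
  have hwc := c.one_le_weight_crosses hw hwt
  rcases Nat.lt_or_ge 1 (c.M.filter fun e => c.a e ≤ w).card with hm | hm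
  · have : (2 : ℝ) ≤ (c.M.filter fun e => c.a e ≤ w).card := by exact_mod_cast hm
    linarith
  rcases hm.lt_or_eq with hm | hm
  · have hM0 : ∀ e ∈ c.M, ¬ c.a e ≤ w := by
      have := Finset.card_eq_zero.1 (Nat.lt_one_iff.1 hm)
      intro e he hle
      exact Finset.notMem_empty e (this ▸ (by simp [he, hle]))
    rw [Nat.lt_one_iff.1 hm]
    obtain ⟨q, hql, hqw⟩ := exists_leaf_le hw hwt
    have hqQ : q ∈ c.Q := by
      rcases c.leaf_cases q hql with h | ⟨e, he, h | h⟩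
      · exact h
      · exact absurd (h ▸ hqw) (hM0 e he)
      · exact absurd ((hiso.1 e he).2 (h ▸ hqw)) (hM0 e he)
    have h1 := c.one_le_weight_crosses hql.1 hql.2.1
    have h2 := weight_le_load₂ (c := c) (Y := c.free w) (P₁ := fun e => c.Crosses e q)
      (P₂ := fun e => c.Crosses e w) (by
        intro g
        have ha := hF _ (c.a_mem g)
        have hb := hF _ (c.b_mem g)
        have ha' := hFQ (c.a g)
        have hb' := hFQ (c.b g)
        have hqg := hcl q hqQ hqw g
        have hac := fun h h' => (hcl (c.a g) h h' g).1 rfl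
        have hbc := fun h h' => (hcl (c.b g) h h' g).2 rfl
        have hg := hQQ g
        unfold ends
        simp only [crosses_leaf hql]
        unfold Crosses Separates
        clear hload hsub heq hiso hnd hQl hF hFQ hcl hwc hm h1 hM0 hQQ
        grind)
    push_cast
    linarith
  obtain ⟨e, he⟩ := Finset.card_eq_one.1 hm
  have heM : e ∈ c.M ∧ c.a e ≤ w := by
    have : e ∈ c.M.filter fun e => c.a e ≤ w := by rw [he]; simp
    simpa using this
  have hun : ∀ f ∈ c.M, c.a f ≤ w → f = e := fun f hf hfw => by
    have : f ∈ c.M.filter fun e => c.a e ≤ w := by simp [hf, hfw]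
    rw [he] at this
    simpa using this
  rw [hm]
  suffices h3 : 3 ≤ c.load (c.free w) by push_cast; linarith
  obtain ⟨u, huQ, huw⟩ : ∃ q ∈ c.Q, q ≤ w := by
    rcases c.third e heM.1 w hw hwt heM.2 ((hiso.1 e heM.1).1 heM.2) with h | ⟨f, hf, hfe, hfw⟩
    · exact h
    · refine absurd (hun f hf ?_) hfe
      rcases hfw with h | h
      · exact h
      · exact (hiso.1 f hf).2 h
  by_cases hu : ∀ q ∈ c.Q, q ≤ w → q = u
  · by_contra hlt
    exact hnd e u ⟨hw, hwt, hiso, heM.1, heM.2, hun, huQ, hQl u huQ huw, huw, hu, not_le.1 hlt⟩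
  push Not at hu
  obtain ⟨q, hqQ, hqw, hqu⟩ := hu
  have hul := hQl u huQ huw
  have hql := hQl q hqQ hqw
  have h1 := c.one_le_weight_crosses hql.1 hql.2.1
  have h2 := c.one_le_weight_crosses hul.1 hul.2.1
  have h3 := weight_le_load₃ (c := c) (Y := c.free w) (P₁ := fun e => c.Crosses e q)
    (P₂ := fun e => c.Crosses e u) (P₃ := fun e => c.Crosses e w) (by
      intro g
      have ha := hF _ (c.a_mem g)
      have hb := hF _ (c.b_mem g)
      have ha' := hFQ (c.a g)
      have hb' := hFQ (c.b g)
      have hac := fun h h' => (hcl (c.a g) h h' g).1 rfl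
      have hbc := fun h h' => (hcl (c.b g) h h' g).2 rfl
      have hg := hQQ g
      unfold ends
      simp only [crosses_leaf hql, crosses_leaf hul]
      unfold Crosses Separates
      clear hload hsub heq hiso hnd hQl hF hFQ hcl hwc hm h1 h2 hQQ hun heM he
      grind)
  linarith

theorem ClosedAt.mono {l v w : V} (h : c.ClosedAt l v) (hvw : v ≤ w) : c.ClosedAt l w :=
  fun e => ⟨fun he => ((h e).1 he).trans hvw, fun he => ((h e).2 he).trans hvw⟩

theorem not_crosses_top (e : ι) : ¬ c.Crosses e ⊤ := by simp [Crosses, Separates]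

theorem ends_le_of_crosses {e : ι} {v w : V} (hv : c.Crosses e v) (hvw : v ≤ w)
    (hw : ¬ c.Crosses e w) : c.a e ≤ w ∧ c.b e ≤ w := by
  unfold Crosses Separates at hv hw
  have h1 : c.a e ≤ v → c.a e ≤ w := fun h => h.trans hvw
  have h2 : c.b e ≤ v → c.b e ≤ w := fun h => h.trans hvw
  tauto

open Classical in
/-- The subtree to be contracted: `σ` replaces the links of `M` in deficient subtrees, `τ q` is the
link that covers the most ancestors of the leaf `q`, or of the leaf that takes its place after the
replacement, and `w` is a lowest node that is not crossed by any of these links. -/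
theorem exists_isolated (c : Config V ι) (hne : ∃ v ∈ c.N, v ≠ ⊤) :
    ∃ w ∈ c.N, ∃ J : Finset ι, c.Isolated w ∧ (∀ e u, ¬ c.Deficient e u w) ∧
      (∀ v ∈ c.N, v < w → ∃ e ∈ J, c.Crosses e v) ∧
      J.card ≤ (c.Q.filter fun q => IsLeaf c.N q ∧ q ≤ w).card
        + (c.M.filter fun e => c.a e ≤ w).card := by
  obtain ⟨v₀, hv₀, hv₀t⟩ := hne
  obtain ⟨e₀, -⟩ := c.exists_crosses hv₀ hv₀t
  have : Nonempty ι := ⟨e₀⟩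
  have hup : ∀ l, ∃ e, IsLeaf c.N l → (c.a e = l ∨ c.b e = l) ∧
      ∀ v ∈ c.N, l ≤ v → ¬ c.Crosses e v → c.ClosedAt l v := fun l => by
    by_cases hl : IsLeaf c.N l
    · obtain ⟨e, he⟩ := c.exists_up hl
      exact ⟨e, fun _ => he⟩
    · exact ⟨e₀, fun h => absurd h hl⟩
  choose up hup using hup
  have hbad : ∀ e, ∃ u v p k f, (∃ u v, c.Deficient e u v) →
      c.Deficient e u v ∧ c.Selected e u p k f := fun e => by
    by_cases he : ∃ u v, c.Deficient e u v
    · obtain ⟨u, v, h⟩ := he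
      obtain ⟨p, k, f, h'⟩ := h.exists_selected
      exact ⟨u, v, p, k, f, fun _ => ⟨h, h'⟩⟩
    · exact ⟨⊤, ⊤, ⊤, ⊤, e, fun h => absurd h he⟩
  choose U W P K F hbad using hbad
  set Bad : ι → Prop := fun e => ∃ u v, c.Deficient e u v with hBad
  have hends : ∀ e, Bad e → ∀ {v}, (P e ≤ v ∨ K e ≤ v → c.a e ≤ v ∨ c.b e ≤ v) ∧
      (c.a e ≤ v → P e ≤ v ∨ K e ≤ v) ∧ (c.b e ≤ v → P e ≤ v ∨ K e ≤ v) ∧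
      (P e ≤ v → K e ≤ v → c.a e ≤ v ∧ c.b e ≤ v) := by
    intro e he v
    rcases (hbad e he).2.link with ⟨h1, h2⟩ | ⟨h1, h2⟩ <;> rw [h1, h2] <;> tauto
  have hPleaf : ∀ e, Bad e → IsLeaf c.N (P e) := fun e he => by
    have := c.M_leaf e (hbad e he).1.link_mem
    rcases (hbad e he).2.link with ⟨h1, h2⟩ | ⟨h1, h2⟩
    · rw [← h1]; exact this.1
    · rw [← h2]; exact this.2.1
  have hPW : ∀ e, Bad e → P e ≤ W e ∧ K e ≤ W e := fun e he => by
    have hd := (hbad e he).1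
    have h1 := hd.link_le
    have h2 := (hd.isolated.1 e hd.link_mem).1 h1
    rcases (hbad e he).2.link with ⟨h3, h4⟩ | ⟨h3, h4⟩
    · exact ⟨h3 ▸ h1, h4 ▸ h2⟩
    · exact ⟨h4 ▸ h2, h3 ▸ h1⟩
  have hUinj : ∀ e f, Bad e → Bad f → U e = U f → e = f := fun e f he hf h => by
    have h1 := (hbad e he).1
    have h2 := (hbad f hf).1
    rcases c.chain (U e) (W e) (W f) h1.u_le (h ▸ h2.u_le) with h3 | h3
    · exact h2.link_unique e h1.link_mem (h1.link_le.trans h3)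
    · exact (h1.link_unique f h2.link_mem (h2.link_le.trans h3)).symm
  set σ : ι → ι := fun e => if Bad e then F e else e with hσ
  obtain ⟨τ, hτ, hτ'⟩ : ∃ τ : V → ι, (∀ e, Bad e → τ (U e) = up (P e)) ∧
      ∀ q, (¬ ∃ e, Bad e ∧ U e = q) → τ q = up q := by
    refine ⟨fun q => if h : ∃ e, Bad e ∧ U e = q then up (P h.choose) else up q, ?_, ?_⟩
    · intro e he
      have h : ∃ f, Bad f ∧ U f = U e := ⟨e, he, rfl⟩
      dsimp only
      rw [dif_pos h, hUinj _ _ h.choose_spec.1 he h.choose_spec.2]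
    · intro q hq
      dsimp only
      rw [dif_neg hq]
  set J : Finset ι := c.M.image σ ∪ (c.Q.filter fun q => IsLeaf c.N q).image τ with hJ
  have hσJ : ∀ e ∈ c.M, σ e ∈ J := fun e he =>
    Finset.mem_union_left _ (Finset.mem_image_of_mem σ he)
  have hτJ : ∀ q ∈ c.Q, IsLeaf c.N q → τ q ∈ J := fun q hq hql =>
    Finset.mem_union_right _ (Finset.mem_image_of_mem τ (by simp [hq, hql]))
  obtain ⟨w, hw⟩ := (c.N.filter fun v => ∀ e ∈ J, ¬ c.Crosses e v).exists_minimal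
    ⟨⊤, by simp [c.top_mem, not_crosses_top]⟩
  obtain ⟨hwN, hwJ⟩ := Finset.mem_filter.1 hw.1
  have hmin : ∀ v ∈ c.N, v < w → ∃ e ∈ J, c.Crosses e v := fun v hv hvw => by
    by_contra! h
    exact hvw.not_ge (hw.2 (by simp [hv]; exact h) hvw.le)
  -- a deficient tree lies inside `w` or has no leaf in common with `w`
  have hin : ∀ e, Bad e → (P e ≤ w ∨ K e ≤ w ∨ U e ≤ w) → W e ≤ w ∧ c.ClosedAt (P e) w := by
    intro e he hor
    have hd := (hbad e he).1
    have hs := (hbad e he).2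
    have hPw : P e ≤ w := by
      by_contra hP
      have h := hwJ _ (hσJ e hd.link_mem)
      simp only [hσ, if_pos he] at h
      have hiff : K e ≤ w ↔ U e ≤ w := by
        unfold Crosses Separates at h
        rcases hs.swap with ⟨h1, h2⟩ | ⟨h1, h2⟩ <;> rw [h1, h2] at h <;> tauto
      exact hP (hs.join_le w hwN (by tauto) (by tauto))
    have hcl : c.ClosedAt (P e) w := by
      refine (hup _ (hPleaf e he)).2 w hwN hPw ?_
      rw [← hτ e he]
      exact hwJ _ (hτJ _ hd.u_mem hd.u_leaf)
    refine ⟨?_, hcl⟩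
    rcases c.chain _ _ _ (hPW e he).1 hPw with h | h
    · exact h
    · exact absurd (hcl.mono h) (hs.not_closedAt hd)
  have hiso : c.Isolated w := by
    constructor
    · intro e he
      by_cases hb : Bad e
      · have h1 : c.a e ≤ w ∨ c.b e ≤ w → c.a e ≤ w ∧ c.b e ≤ w := fun h => by
          have h2 : P e ≤ w ∨ K e ≤ w := by
            rcases h with h | h
            · exact (hends e hb).2.1 h
            · exact (hends e hb).2.2.1 h
          have h3 := (hin e hb (by tauto)).1
          exact (hends e hb).2.2.2 ((hPW e hb).1.trans h3) ((hPW e hb).2.trans h3)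
        tauto
      · have h := hwJ _ (hσJ e he)
        simp only [hσ, if_neg hb] at h
        unfold Crosses Separates at h
        tauto
    · intro q hq hql hqw
      by_cases hU : ∃ e, Bad e ∧ U e = q
      · obtain ⟨e, he, rfl⟩ := hU
        exact (hbad e he).1.closedAt.mono (hin e he (by tauto)).1
      · refine (hup _ hql).2 w hwN hqw ?_
        rw [← hτ' q hU]
        exact hwJ _ (hτJ _ hq hql)
  refine ⟨w, hwN, (c.M.filter fun e => c.a e ≤ w).image σ ∪
    (c.Q.filter fun q => IsLeaf c.N q ∧ q ≤ w).image τ, hiso, ?_, ?_, ?_⟩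
  · intro e u hd
    have he : Bad e := ⟨u, w, hd⟩
    have hin' := hin e he (by have := (hends e he).2.1 hd.link_le; tauto)
    have hu : U e = u :=
      hd.u_unique _ (hbad e he).1.u_mem ((hbad e he).1.u_le.trans hin'.1)
    exact (hbad e he).2.not_closedAt (hu ▸ hd) hin'.2
  · intro v hv hvw
    obtain ⟨g, hgJ, hgv⟩ := hmin v hv hvw
    have hgw := ends_le_of_crosses hgv hvw.le (hwJ g hgJ)
    refine ⟨g, ?_, hgv⟩
    rcases Finset.mem_union.1 hgJ with hg | hg
    · obtain ⟨e, he, rfl⟩ := Finset.mem_image.1 hg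
      refine Finset.mem_union_left _ (Finset.mem_image_of_mem σ (Finset.mem_filter.2 ⟨he, ?_⟩))
      by_cases hb : Bad e
      · simp only [hσ, if_pos hb] at hgw
        have hK : K e ≤ w := by
          rcases (hbad e hb).2.swap with ⟨h1, h2⟩ | ⟨h1, h2⟩
          · exact h1 ▸ hgw.1
          · exact h2 ▸ hgw.2
        exact (hbad e hb).1.link_le.trans (hin e hb (by tauto)).1
      · simp only [hσ, if_neg hb] at hgw
        exact hgw.1
    · obtain ⟨q, hq, rfl⟩ := Finset.mem_image.1 hg
      obtain ⟨hqQ, hql⟩ := Finset.mem_filter.1 hq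
      refine Finset.mem_union_right _ (Finset.mem_image_of_mem τ
        (Finset.mem_filter.2 ⟨hqQ, hql, ?_⟩))
      by_cases hU : ∃ e, Bad e ∧ U e = q
      · obtain ⟨e, he, rfl⟩ := hU
        rw [hτ e he] at hgw
        have hP : P e ≤ w := by
          rcases (hup _ (hPleaf e he)).1 with h | h
          · exact h ▸ hgw.1
          · exact h ▸ hgw.2
        exact (hbad e he).1.u_le.trans (hin e he (by tauto)).1
      · rw [hτ' q hU] at hgw
        rcases (hup _ hql).1 with h | h
        · exact h ▸ hgw.1
        · exact h ▸ hgw.2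
  · refine (Finset.card_union_le _ _).trans ?_
    rw [add_comm]
    exact Nat.add_le_add Finset.card_image_le Finset.card_image_le

/-- The current tree edges can be covered by as many links as there is credit, by induction on the
number of nodes. -/
theorem exists_cover (c : Config V ι) : ∃ J : Finset ι,
    (∀ v ∈ c.N, v ≠ ⊤ → ∃ e ∈ J, c.Crosses e v) ∧ (J.card : ℝ) ≤ c.potential := by
  classical
  induction hn : c.N.card using Nat.strong_induction_on generalizing c with
  | _ n ih =>
  have step : ∀ (S : Finset V) (t : V) (J : Finset ι), S ⊆ c.N → S.Nonempty → t ∈ c.N → t ∉ S →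
      (∀ s ∈ S, s ≤ t) → (∀ s ∈ S, ∀ v ∈ c.N, v ∉ S → s ≤ v → t ≤ v) →
      (∀ e ∈ c.M, c.a e ∈ S ↔ c.b e ∈ S) → (∀ s ∈ S, ∃ e ∈ J, c.Crosses e s) →
      ((J.card : ℝ) + 1 ≤ (c.Q ∩ insert t S).card
        + ((c.M.filter fun e => c.a e ∈ S).card : ℝ) / 2 + c.load (insert t S \ c.Q) / 2) →
      ∃ J : Finset ι, (∀ v ∈ c.N, v ≠ ⊤ → ∃ e ∈ J, c.Crosses e v) ∧
        (J.card : ℝ) ≤ c.potential := by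
    intro S t J hSN hne htN htS hSt hup hM hJ hcost
    obtain ⟨c', hN, hcr, hpot⟩ := c.exists_contract hSN hne htN htS hSt hup hM hcost
    obtain ⟨J', hJ', hcard⟩ := ih c'.N.card (by
      rw [hN, ← hn]
      obtain ⟨s, hs⟩ := hne
      exact Finset.card_lt_card (Finset.ssubset_iff_subset_ne.2 ⟨Finset.sdiff_subset, fun h => by
        have : s ∈ c.N \ S := by rw [h]; exact hSN hs
        exact (Finset.mem_sdiff.1 this).2 hs⟩)) c' rfl
    refine ⟨J' ∪ J, fun v hv hvt => ?_, ?_⟩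
    · by_cases hvS : v ∈ S
      · obtain ⟨e, he, h⟩ := hJ v hvS
        exact ⟨e, Finset.mem_union_right _ he, h⟩
      · have hv' : v ∈ c'.N := by rw [hN]; simp [hv, hvS]
        obtain ⟨e, he, h⟩ := hJ' v hv' hvt
        exact ⟨e, Finset.mem_union_left _ he, (hcr e v hv').1 h⟩
    · have : ((J' ∪ J).card : ℝ) ≤ J'.card + J.card := by exact_mod_cast Finset.card_union_le _ _
      linarith
  by_cases hQQ : ∃ e, c.a e ∈ c.Q ∧ c.b e ∈ c.Q ∧ c.a e ≠ c.b e
  -- a link joining two nodes of `Q`: their two units pay for it and for the contracted path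
  · obtain ⟨e, ha, hb, hab⟩ := hQQ
    obtain ⟨t, ht⟩ := (c.N.filter fun v => c.a e ≤ v ∧ c.b e ≤ v).exists_minimal
      ⟨⊤, by simp [c.top_mem]⟩
    obtain ⟨htN, hat, hbt⟩ := Finset.mem_filter.1 ht.1
    have hleast : ∀ v ∈ c.N, c.a e ≤ v → c.b e ≤ v → t ≤ v := fun v hv h1 h2 => by
      rcases c.chain _ _ _ hat h1 with h | h
      · exact h
      · exact ht.2 (by simp [hv, h1, h2]) h
    have hmem : ∀ v, v ∈ c.N.filter (fun v => c.Crosses e v) ↔ v ∈ c.N ∧ c.Crosses e v := by simp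
    have haS : c.a e ∈ insert t (c.N.filter fun v => c.Crosses e v) := by
      by_cases h : c.b e ≤ c.a e
      · exact Finset.mem_insert.2 (Or.inl (le_antisymm hat (hleast _ (c.a_mem e) le_rfl h)))
      · exact Finset.mem_insert_of_mem ((hmem _).2 ⟨c.a_mem e, fun h' => h (h'.1 le_rfl)⟩)
    have hbS : c.b e ∈ insert t (c.N.filter fun v => c.Crosses e v) := by
      by_cases h : c.a e ≤ c.b e
      · exact Finset.mem_insert.2 (Or.inl (le_antisymm hbt (hleast _ (c.b_mem e) h le_rfl)))
      · exact Finset.mem_insert_of_mem ((hmem _).2 ⟨c.b_mem e, fun h' => h (h'.2 le_rfl)⟩)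
    have hleafS : ∀ l, IsLeaf c.N l → l ∉ c.Q → ¬ c.Crosses e l := fun l hl hlQ h => by
      rw [crosses_leaf hl] at h
      by_cases h1 : c.a e = l
      · exact hlQ (h1 ▸ ha)
      · by_cases h2 : c.b e = l
        · exact hlQ (h2 ▸ hb)
        · tauto
    refine step (c.N.filter fun v => c.Crosses e v) t {e} (Finset.filter_subset ..) ?_ htN ?_ ?_ ?_
      ?_ ?_ ?_
    · by_contra hemp
      rw [Finset.not_nonempty_iff_eq_empty] at hemp
      rw [hemp] at haS hbS
      simp only [Finset.mem_insert, Finset.notMem_empty, or_false] at haS hbS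
      exact hab (haS.trans hbS.symm)
    · intro h
      exact ((hmem t).1 h).2 (iff_of_true hat hbt)
    · intro s hs
      obtain ⟨hsN, hs⟩ := (hmem s).1 hs
      unfold Crosses Separates at hs
      by_cases h1 : c.a e ≤ s
      · rcases c.chain _ _ _ h1 hat with h | h
        · exact h
        · exact absurd (iff_of_true h1 (hbt.trans h)) hs
      · have h2 : c.b e ≤ s := by tauto
        rcases c.chain _ _ _ h2 hbt with h | h
        · exact h
        · exact absurd (iff_of_true (hat.trans h) h2) hs
    · intro s hs v hv hvS hsv
      obtain ⟨hsN, hs⟩ := (hmem s).1 hs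
      have hvc : ¬ c.Crosses e v := fun h => hvS ((hmem v).2 ⟨hv, h⟩)
      have := ends_le_of_crosses hs hsv hvc
      exact hleast v hv this.1 this.2
    · intro f hf
      have h := c.M_leaf f hf
      exact iff_of_false (fun h' => hleafS _ h.1 h.2.2.2.1 ((hmem _).1 h').2)
        (fun h' => hleafS _ h.2.1 h.2.2.2.2 ((hmem _).1 h').2)
    · intro s hs
      exact ⟨e, by simp, ((hmem s).1 hs).2⟩
    · have h2 : 2 ≤ (c.Q ∩ insert t (c.N.filter fun v => c.Crosses e v)).card := by
        rw [← Finset.card_pair hab]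
        refine Finset.card_le_card fun z hz => ?_
        rcases Finset.mem_insert.1 hz with rfl | hz
        · exact Finset.mem_inter.2 ⟨ha, haS⟩
        · rw [Finset.mem_singleton.1 hz]
          exact Finset.mem_inter.2 ⟨hb, hbS⟩
      have h2' : (2 : ℝ) ≤ (c.Q ∩ insert t (c.N.filter fun v => c.Crosses e v)).card := by
        exact_mod_cast h2
      have h3 := c.load_nonneg (insert t (c.N.filter fun v => c.Crosses e v) \ c.Q)
      rw [Finset.card_singleton]
      push_cast
      have : (0 : ℝ) ≤ ((c.M.filter fun f => c.a f ∈ c.N.filter fun v => c.Crosses e v).card : ℝ) :=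
        Nat.cast_nonneg _
      linarith
  · push Not at hQQ
    by_cases hne : ∃ v ∈ c.N, v ≠ ⊤
    · obtain ⟨w, hwN, J, hiso, hnd, hJ, hcard⟩ := c.exists_isolated hne
      by_cases hwt : w = ⊤
      -- the whole tree is covered, and no credit is needed for the contracted node
      · subst hwt
        refine ⟨J, fun v hv hvt => hJ v hv (lt_top_iff_ne_top.2 hvt), ?_⟩
        have h1 : 2 * (c.M.card : ℝ) ≤ c.load (c.N \ c.Q) :=
          two_mul_card_le_load subset_rfl fun e he => by
            have := c.M_leaf e he
            simp [c.a_mem, c.b_mem, this.2.2.2.1, this.2.2.2.2]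
        have h2 : (J.card : ℝ) ≤ c.Q.card + c.M.card := by
          exact_mod_cast hcard.trans (Nat.add_le_add (Finset.card_filter_le ..)
            (Finset.card_filter_le ..))
        unfold potential
        linarith
      · have hcount := hiso.card_add_one_le hwN hwt hQQ hnd
        -- an isolated subtree is not a single leaf, hence its contraction removes some node
        have hwl : ¬ IsLeaf c.N w := fun hl => by
          rcases c.leaf_cases w hl with h | ⟨e, he, h⟩
          · obtain ⟨g, hg⟩ := c.exists_crosses hwN hwt
            have hcl := hiso.2 w h hl le_rfl g
            rw [le_leaf_iff hl (c.a_mem g), le_leaf_iff hl (c.b_mem g)] at hcl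
            rw [crosses_leaf hl] at hg
            tauto
          · have h1 := hiso.1 e he
            rw [le_leaf_iff hl (c.a_mem e), le_leaf_iff hl (c.b_mem e)] at h1
            have h2 : c.a e = w ∧ c.b e = w := by tauto
            exact (c.M_leaf e he).2.2.1 (h2.1.trans h2.2.symm)
        have hlt : ∀ l, IsLeaf c.N l → (l < w ↔ l ≤ w) := fun l hl =>
          ⟨le_of_lt, fun h => lt_of_le_of_ne h fun h' => hwl (h' ▸ hl)⟩
        have hmem : ∀ v, v ∈ c.N.filter (fun v => v < w) ↔ v ∈ c.N ∧ v < w := by simp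
        have hins : ∀ v, v ∈ insert w (c.N.filter fun v => v < w) ↔ v ∈ c.N ∧ v ≤ w := fun v => by
          rw [Finset.mem_insert, hmem, le_iff_eq_or_lt]
          refine ⟨?_, by tauto⟩
          rintro (rfl | h)
          · exact ⟨hwN, Or.inl rfl⟩
          · exact ⟨h.1, Or.inr h.2⟩
        refine step (c.N.filter fun v => v < w) w J (Finset.filter_subset ..) ?_ hwN (by simp) ?_ ?_
          ?_ ?_ ?_
        · by_contra hemp
          rw [Finset.not_nonempty_iff_eq_empty] at hemp
          refine hwl ⟨hwN, hwt, fun u hu huw => ?_⟩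
          by_contra hne
          exact Finset.notMem_empty u (hemp ▸ (hmem u).2 ⟨hu, lt_of_le_of_ne huw hne⟩)
        · exact fun s hs => ((hmem s).1 hs).2.le
        · intro s hs v hv hvS hsv
          rcases c.chain _ _ _ hsv ((hmem s).1 hs).2.le with h | h
          · by_contra hwv
            exact hvS ((hmem v).2 ⟨hv, lt_of_le_of_ne h fun h' => hwv h'.ge⟩)
          · exact h
        · intro e he
          have hl := c.M_leaf e he
          rw [hmem, hmem, hlt _ hl.1, hlt _ hl.2.1, hiso.1 e he]
          simp [c.a_mem, c.b_mem]
        · exact fun s hs => hJ s ((hmem s).1 hs).1 ((hmem s).1 hs).2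
        · have e1 : c.Q ∩ insert w (c.N.filter fun v => v < w) = c.Q.filter fun q => q ≤ w := by
            ext z
            rw [Finset.mem_inter, hins, Finset.mem_filter]
            exact ⟨fun h => ⟨h.1, h.2.2⟩, fun h => ⟨h.1, c.Q_sub h.1, h.2⟩⟩
          have e2 : (c.M.filter fun e => c.a e ∈ c.N.filter fun v => v < w) =
              c.M.filter fun e => c.a e ≤ w := by
            refine Finset.filter_congr fun e he => ?_
            rw [hmem, hlt _ (c.M_leaf e he).1]
            simp [c.a_mem]
          have e3 : insert w (c.N.filter fun v => v < w) \ c.Q = c.free w := by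
            ext z
            rw [Finset.mem_sdiff, hins, mem_free, and_assoc]
          rw [e1, e2, e3]
          have : (J.card : ℝ) ≤ (c.Q.filter fun q => IsLeaf c.N q ∧ q ≤ w).card
              + (c.M.filter fun e => c.a e ≤ w).card := by exact_mod_cast hcard
          linarith
    · push Not at hne
      refine ⟨∅, fun v hv hvt => absurd (hne v hv) hvt, ?_⟩
      have := c.load_nonneg (c.N \ c.Q)
      unfold potential
      rw [Finset.card_empty]
      push_cast
      positivity

end Config

/-! ### The initial bound -/

section Stems

variable [PartialOrder V] [OrderTop V]

open Classical in
/-- The leaves of the tree `N` below `s`. -/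
noncomputable def leavesBelow (N : Finset V) (s : V) : Finset V :=
  N.filter fun l => IsLeaf N l ∧ l ≤ s

/-- A stem: a lowest node, other than the root, with exactly two leaves below it. -/
structure IsStem (N : Finset V) (s : V) : Prop where
  mem : s ∈ N
  ne_top : s ≠ ⊤
  card_eq : (leavesBelow N s).card = 2
  minimal : ∀ s' ∈ N, s' < s → (leavesBelow N s').card ≠ 2

/-- `p` and `q` are the two leaves below a stem. -/
def IsTwin (N : Finset V) (p q : V) : Prop :=
  IsLeaf N p ∧ IsLeaf N q ∧ p ≠ q ∧ ∃ s, IsStem N s ∧ p ≤ s ∧ q ≤ s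

variable {N : Finset V}

theorem mem_leavesBelow {s l : V} : l ∈ leavesBelow N s ↔ IsLeaf N l ∧ l ≤ s := by
  simp only [leavesBelow, Finset.mem_filter]
  exact ⟨fun h => h.2, fun h => ⟨h.1.1, h⟩⟩

theorem isTwin_of_mem_leavesBelow_iff {v p q : V} (hv : v ∈ N) (hvt : v ≠ ⊤) (hpq : p ≠ q)
    (h : ∀ l, l ∈ leavesBelow N v ↔ l = p ∨ l = q) : IsTwin N p q := by
  classical
  have hlv : leavesBelow N v = {p, q} := by ext l; simp [h]
  have hcard : (leavesBelow N v).card = 2 := by rw [hlv, Finset.card_pair hpq]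
  obtain ⟨s, hs⟩ := (N.filter fun s => s ≤ v ∧ (leavesBelow N s).card = 2).exists_minimal
    ⟨v, by simp [hv, hcard]⟩
  obtain ⟨hsN, hsv, hsc⟩ := Finset.mem_filter.1 hs.1
  have heq : leavesBelow N s = leavesBelow N v := by
    refine Finset.eq_of_subset_of_card_le (fun l hl => ?_) (by rw [hcard, hsc])
    rw [mem_leavesBelow] at hl ⊢
    exact ⟨hl.1, hl.2.trans hsv⟩
  have hp := mem_leavesBelow.1 (heq.symm ▸ (h p).2 (Or.inl rfl))
  have hq := mem_leavesBelow.1 (heq.symm ▸ (h q).2 (Or.inr rfl))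
  refine ⟨hp.1, hq.1, hpq, s, ⟨hsN, fun h => hvt (top_unique (h ▸ hsv)), hsc, ?_⟩, hp.2, hq.2⟩
  intro s' hs' hlt hcard'
  exact hlt.not_ge (hs.2 (by simp [hs', hlt.le.trans hsv, hcard']) hlt.le)

theorem IsStem.eq_of_le {s s' z : V} (hchain : ∀ u v w : V, u ≤ v → u ≤ w → v ≤ w ∨ w ≤ v)
    (hs : IsStem N s) (hs' : IsStem N s') (hz : z ≤ s) (hz' : z ≤ s') : s = s' := by
  by_contra hne
  rcases hchain z s s' hz hz' with h | h
  · exact hs'.minimal s hs.mem (lt_of_le_of_ne h hne) hs.card_eq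
  · exact hs.minimal s' hs'.mem (lt_of_le_of_ne h (Ne.symm hne)) hs'.card_eq

end Stems

namespace Config

variable [PartialOrder V] [OrderTop V] [Fintype ι] {c : Config V ι}

theorem load_eq_sum (Y : Finset V) : c.load Y = ∑ v ∈ Y, c.load {v} := by
  classical
  induction Y using Finset.induction_on with
  | empty => simp [load, ends]
  | insert l Y hl ih =>
    rw [Finset.sum_insert hl, Finset.insert_eq, load_union (Finset.disjoint_singleton_left.2 hl), ih]

/-- The fork constraint of a stem and its two leaves: as a link between the two leaves counts once
in the constraint, but has two ends in the subtree, it can be counted once more. -/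
theorem two_add_weight_le_load_below {s : V} (hs : IsStem c.N s) :
    2 + weight c.x (fun e => IsLeaf c.N (c.a e) ∧ IsLeaf c.N (c.b e) ∧ c.a e ≠ c.b e ∧
      c.a e ≤ s ∧ c.b e ≤ s) ≤ c.load (c.below s) := by
  classical
  obtain ⟨p, q, hpq, hset⟩ := Finset.card_eq_two.1 hs.card_eq
  have hp : IsLeaf c.N p ∧ p ≤ s := mem_leavesBelow.1 (by rw [hset]; simp)
  have hq : IsLeaf c.N q ∧ q ≤ s := mem_leavesBelow.1 (by rw [hset]; simp)
  have h2 := c.fork p hp.1.1 q hq.1.1 s hs.mem hs.ne_top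
    (lt_of_le_of_ne hp.2 fun h => hpq (hp.1.2.2 q hq.1.1 (h ▸ hq.2)).symm)
    (lt_of_le_of_ne hq.2 fun h => hpq (hq.1.2.2 p hp.1.1 (h ▸ hp.2)))
    (fun h => hpq (hq.1.2.2 p hp.1.1 h)) (fun h => hpq (hp.1.2.2 q hq.1.1 h).symm)
  refine le_trans (add_le_add_left h2 _) (weight_le_load₂ fun g => ?_)
  have ha : c.a g ∈ c.below s ↔ c.a g ≤ s := by simp [mem_below, c.a_mem]
  have hb : c.b g ∈ c.below s ↔ c.b g ≤ s := by simp [mem_below, c.b_mem]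
  have h1 : ∀ z, z ≤ p → z ≤ s := fun z h => h.trans hp.2
  have h1' : ∀ z, z ≤ q → z ≤ s := fun z h => h.trans hq.2
  have := h1 (c.a g)
  have := h1 (c.b g)
  have := h1' (c.a g)
  have := h1' (c.b g)
  unfold ends Separates
  simp only [ha, hb]
  clear h1 h1' h2 hset hs hp hq ha hb
  grind

open Classical in
/-- The subtrees of the stems are disjoint, and a leaf outside them has degree at least `1`. -/
theorem card_leaves_add_weight_le_load (c : Config V ι) :
    ((c.N.filter fun l => IsLeaf c.N l).card : ℝ)
      + weight c.x (fun e => IsTwin c.N (c.a e) (c.b e)) ≤ c.load c.N := by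
  set St := c.N.filter fun s => IsStem c.N s with hSt
  have hmem : ∀ s, s ∈ St ↔ IsStem c.N s := fun s => by
    simp only [hSt, Finset.mem_filter]
    exact ⟨fun h => h.2, fun h => ⟨h.mem, h⟩⟩
  set R := c.N.filter fun l => IsLeaf c.N l ∧ ∀ s ∈ St, ¬ l ≤ s with hR
  have htwin : weight c.x (fun e => IsTwin c.N (c.a e) (c.b e)) ≤
      ∑ s ∈ St, weight c.x (fun e => IsLeaf c.N (c.a e) ∧ IsLeaf c.N (c.b e) ∧ c.a e ≠ c.b e ∧
        c.a e ≤ s ∧ c.b e ≤ s) := by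
    refine weight_le_sum_weight c.x_nonneg fun e h => ?_
    obtain ⟨h1, h2, h3, s, hs, h4, h5⟩ := h
    exact ⟨s, (hmem s).2 hs, h1, h2, h3, h4, h5⟩
  have hdisj : (St : Set V).PairwiseDisjoint c.below := by
    intro s hs s' hs' hne
    rw [Function.onFun, Finset.disjoint_left]
    intro z hz hz'
    exact hne (((hmem s).1 hs).eq_of_le c.chain ((hmem s').1 hs') (mem_below.1 hz).2
      (mem_below.1 hz').2)
  have hdisj' : Disjoint (St.biUnion c.below) R := by
    rw [Finset.disjoint_left]
    intro z hz hz'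
    obtain ⟨s, hs, hzs⟩ := Finset.mem_biUnion.1 hz
    exact (Finset.mem_filter.1 hz').2.2 s hs (mem_below.1 hzs).2
  have hsub : St.biUnion c.below ∪ R ⊆ c.N := by
    intro z hz
    rcases Finset.mem_union.1 hz with hz | hz
    · obtain ⟨s, hs, hzs⟩ := Finset.mem_biUnion.1 hz
      exact (mem_below.1 hzs).1
    · exact (Finset.mem_filter.1 hz).1
  have hload : ∑ s ∈ St, c.load (c.below s) + c.load R ≤ c.load c.N := by
    refine le_trans (le_of_eq ?_) (load_mono hsub)
    rw [load_union hdisj', load_eq_sum (St.biUnion _), Finset.sum_biUnion hdisj]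
    simp only [← load_eq_sum]
  have hRload : (R.card : ℝ) ≤ c.load R := card_le_load fun l hl => (Finset.mem_filter.1 hl).2.1
  have hcard : ((c.N.filter fun l => IsLeaf c.N l).card : ℝ) ≤ 2 * St.card + R.card := by
    have h1 : (c.N.filter fun l => IsLeaf c.N l) ⊆ St.biUnion (leavesBelow c.N) ∪ R := by
      intro l hl
      obtain ⟨hlN, hl⟩ := Finset.mem_filter.1 hl
      by_cases h : ∃ s ∈ St, l ≤ s
      · obtain ⟨s, hs, hls⟩ := h
        exact Finset.mem_union_left _ (Finset.mem_biUnion.2 ⟨s, hs, mem_leavesBelow.2 ⟨hl, hls⟩⟩)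
      · push Not at h
        exact Finset.mem_union_right _ (Finset.mem_filter.2 ⟨hlN, hl, h⟩)
    have h2 : (St.biUnion (leavesBelow c.N)).card ≤ St.card * 2 :=
      Finset.card_biUnion_le_card_mul _ _ _ fun s hs => ((hmem s).1 hs).card_eq.le
    have h3 := (Finset.card_le_card h1).trans (Finset.card_union_le _ _)
    have h4 : (c.N.filter fun l => IsLeaf c.N l).card ≤ 2 * St.card + R.card := by omega
    exact_mod_cast h4
  have hsum : ∑ s ∈ St, (2 + weight c.x (fun e => IsLeaf c.N (c.a e) ∧ IsLeaf c.N (c.b e) ∧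
      c.a e ≠ c.b e ∧ c.a e ≤ s ∧ c.b e ≤ s)) ≤ ∑ s ∈ St, c.load (c.below s) :=
    Finset.sum_le_sum fun s hs => two_add_weight_le_load_below ((hmem s).1 hs)
  rw [Finset.sum_add_distrib, Finset.sum_const, nsmul_eq_mul] at hsum
  linarith

/-- If the nodes of `Q` are leaves joined only by twin links, then the credit is at most `7/4` times
the total weight of the links. -/
theorem potential_le (c : Config V ι) (hloop : ∀ e, c.a e = c.b e → c.x e = 0)
    (hQ : ∀ q ∈ c.Q, IsLeaf c.N q)
    (hQQ : ∀ e, c.a e ∈ c.Q → c.b e ∈ c.Q → c.a e ≠ c.b e → IsTwin c.N (c.a e) (c.b e)) :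
    c.potential ≤ 7 / 4 * ∑ e, c.x e := by
  classical
  have hN : c.load c.N = 2 * ∑ e, c.x e := by
    unfold load ends
    rw [Finset.mul_sum]
    refine Finset.sum_congr rfl fun e _ => ?_
    rw [if_pos (c.a_mem e), if_pos (c.b_mem e)]
    ring
  have hsplit : c.load c.N = c.load c.Q + c.load (c.N \ c.Q) := by
    rw [← load_union Finset.disjoint_sdiff, Finset.union_sdiff_of_subset c.Q_sub]
  have hQload : (c.Q.card : ℝ) ≤ c.load c.Q := card_le_load hQ
  have hQup : c.load c.Q ≤ ∑ e, c.x e + weight c.x (fun e => IsTwin c.N (c.a e) (c.b e)) := by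
    unfold load weight ends
    rw [← Finset.sum_add_distrib]
    refine Finset.sum_le_sum fun e _ => ?_
    have hx := c.x_nonneg e
    by_cases ha : c.a e ∈ c.Q <;> by_cases hb : c.b e ∈ c.Q
    · by_cases hab : c.a e = c.b e
      · simp [hloop e hab]
      · rw [if_pos ha, if_pos hb, if_pos (hQQ e ha hb hab)]
        linarith
    all_goals
      simp only [ha, hb, if_true, if_false]
      split_ifs <;> linarith
  have hleaves : (c.Q.card : ℝ) + 2 * c.M.card ≤ (c.N.filter fun l => IsLeaf c.N l).card := by
    have hd : Disjoint c.Q (c.M.image c.a ∪ c.M.image c.b) := by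
      rw [Finset.disjoint_left]
      exact fun l hl hl' => (isLeaf_of_mem_ends subset_rfl hl').2 hl
    have h := Finset.card_le_card (s := c.Q ∪ (c.M.image c.a ∪ c.M.image c.b))
      (t := c.N.filter fun l => IsLeaf c.N l) (fun l hl => by
        have hl' : IsLeaf c.N l := by
          rcases Finset.mem_union.1 hl with hl | hl
          · exact hQ l hl
          · exact (isLeaf_of_mem_ends subset_rfl hl).1
        exact Finset.mem_filter.2 ⟨hl'.1, hl'⟩)
    rw [Finset.card_union_of_disjoint hd, card_ends subset_rfl] at h
    exact_mod_cast h
  have := c.card_leaves_add_weight_le_load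
  unfold potential
  linarith

end Config

/-- The rooted form of the theorem: weights of links that satisfy the cut and the fork constraints of
a tree order have `7/4` times the weight of a cover. -/
theorem exists_card_le_of_rooted [Fintype V] [PartialOrder V] [OrderTop V] [Fintype ι]
    (hchain : ∀ u v w : V, u ≤ v → u ≤ w → v ≤ w ∨ w ≤ v)
    (a b : ι → V) (x : ι → ℝ) (hx : ∀ e, 0 ≤ x e) (hloop : ∀ e, a e = b e → x e = 0)
    (hcut : ∀ v, v ≠ ⊤ → 1 ≤ weight x fun e => Separates v (a e) (b e))
    (hfork : ∀ u v w : V, w ≠ ⊤ → u < w → v < w → ¬ u ≤ v → ¬ v ≤ u →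
      2 ≤ weight x fun e =>
        Separates u (a e) (b e) ∨ Separates v (a e) (b e) ∨ Separates w (a e) (b e)) :
    ∃ J : Finset ι, (∀ v, v ≠ ⊤ → ∃ e ∈ J, Separates v (a e) (b e)) ∧
      (J.card : ℝ) ≤ 7 / 4 * ∑ e, x e := by
  classical
  let N : Finset V := Finset.univ
  let Good : Finset ι → Prop := fun M =>
    (∀ e ∈ M, IsLeaf N (a e) ∧ IsLeaf N (b e) ∧ a e ≠ b e ∧ ¬ IsTwin N (a e) (b e)) ∧
    ∀ e ∈ M, ∀ f ∈ M, e ≠ f → a e ≠ a f ∧ a e ≠ b f ∧ b e ≠ a f ∧ b e ≠ b f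
  obtain ⟨M, hM, hmax⟩ := Finset.exists_max_image (Finset.univ.filter Good) Finset.card
    ⟨∅, by simp [Good]⟩
  obtain ⟨hM1, hM2⟩ := (Finset.mem_filter.1 hM).2
  let Q : Finset V := N.filter fun l => IsLeaf N l ∧ ∀ e ∈ M, a e ≠ l ∧ b e ≠ l
  have hmemQ : ∀ l, l ∈ Q ↔ IsLeaf N l ∧ ∀ e ∈ M, a e ≠ l ∧ b e ≠ l := fun l => by
    simp [Q, N]
  have hQQ : ∀ e, a e ∈ Q → b e ∈ Q → a e ≠ b e → IsTwin N (a e) (b e) := by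
    intro e ha hb hab
    rw [hmemQ] at ha hb
    by_contra htw
    have heM : e ∉ M := fun h => (ha.2 e h).1 rfl
    have hins : Good (insert e M) := by
      constructor
      · intro f hf
        rcases Finset.mem_insert.1 hf with rfl | hf
        · exact ⟨ha.1, hb.1, hab, htw⟩
        · exact hM1 f hf
      · intro f hf g hg hfg
        rcases Finset.mem_insert.1 hf with hfe | hf' <;>
          rcases Finset.mem_insert.1 hg with hge | hg'
        · exact absurd (hfe.trans hge.symm) hfg
        · have h1 := ha.2 g hg'
          have h2 := hb.2 g hg'
          rw [hfe]
          exact ⟨h1.1.symm, h1.2.symm, h2.1.symm, h2.2.symm⟩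
        · have h1 := ha.2 f hf'
          have h2 := hb.2 f hf'
          rw [hge]
          exact ⟨h1.1, h2.1, h1.2, h2.2⟩
        · exact hM2 f hf' g hg' hfg
    have := hmax (insert e M) (by simp [hins])
    rw [Finset.card_insert_of_notMem heM] at this
    omega
  let c : Config V ι :=
    { x := x, N := N, a := a, b := b, Q := Q, M := M
      x_nonneg := hx
      chain := hchain
      top_mem := Finset.mem_univ _
      a_mem := fun _ => Finset.mem_univ _
      b_mem := fun _ => Finset.mem_univ _
      cut := fun v _ hv => hcut v hv
      fork := fun u _ v _ w _ => hfork u v w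
      Q_sub := Finset.filter_subset ..
      leaf_cases := fun v hv => by
        by_cases h : v ∈ Q
        · exact Or.inl h
        · right
          rw [hmemQ] at h
          by_contra! h'
          exact h ⟨hv, fun e he => h' e he⟩
      M_leaf := fun e he => by
        obtain ⟨h1, h2, h3, -⟩ := hM1 e he
        exact ⟨h1, h2, h3, fun h => (((hmemQ _).1 h).2 e he).1 rfl,
          fun h => (((hmemQ _).1 h).2 e he).2 rfl⟩
      M_disj := hM2
      third := fun e he v hv hvt h1 h2 => by
        obtain ⟨h3, h4, h5, h6⟩ := hM1 e he
        by_contra! hno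
        refine h6 (isTwin_of_mem_leavesBelow_iff hv hvt h5 fun l => ?_)
        rw [mem_leavesBelow]
        constructor
        · rintro ⟨hl, hlv⟩
          by_contra! hl'
          refine hno.1 l ((hmemQ l).2 ⟨hl, fun f hf => ?_⟩) hlv
          by_cases hfe : f = e
          · subst hfe
            exact ⟨hl'.1.symm, hl'.2.symm⟩
          · have := hno.2 f hf hfe
            exact ⟨fun h => this.1 (h ▸ hlv), fun h => this.2 (h ▸ hlv)⟩
        · rintro (rfl | rfl)
          · exact ⟨h3, h1⟩
          · exact ⟨h4, h2⟩ }
  obtain ⟨J, hJ, hcard⟩ := c.exists_cover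
  exact ⟨J, fun v hv => hJ v (Finset.mem_univ v) hv,
    hcard.trans (c.potential_le hloop (fun q hq => ((hmemQ q).1 hq).1) hQQ)⟩

end Rooted

/-! ### Rooting the tree -/

section Graph

variable {V : Type*}

/-- A choice of a root of `T`, given by the parent function and a depth that decreases towards the
root. -/
structure Rooting (T : SimpleGraph V) where
  /-- the root -/
  root : V
  /-- the parent of a node; the root is its own parent -/
  parent : V → V
  /-- the distance to the root, or any other function decreasing along `parent` -/
  depth : V → ℕ
  parent_root : parent root = root
  depth_parent_lt : ∀ v, v ≠ root → depth (parent v) < depth v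
  adj_parent : ∀ v, v ≠ root → T.Adj v (parent v)
  parent_eq_or : ∀ u v, T.Adj u v → parent u = v ∨ parent v = u

namespace Rooting

variable {T : SimpleGraph V} (R : Rooting T)

/-- `u` is a descendant of `v`. -/
def Below (u v : V) : Prop := ∃ n : ℕ, R.parent^[n] u = v

variable {R}

theorem below_refl (u : V) : R.Below u u := ⟨0, rfl⟩

theorem below_trans {u v w : V} : R.Below u v → R.Below v w → R.Below u w := by
  rintro ⟨m, rfl⟩ ⟨n, rfl⟩
  exact ⟨n + m, Function.iterate_add_apply ..⟩

theorem below_parent (u : V) : R.Below u (R.parent u) := ⟨1, rfl⟩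

theorem below_iff {u v : V} : R.Below u v ↔ u = v ∨ R.Below (R.parent u) v := by
  constructor
  · rintro ⟨n, hn⟩
    cases n with
    | zero => exact Or.inl hn
    | succ n => exact Or.inr ⟨n, hn⟩
  · rintro (rfl | h)
    · exact below_refl u
    · exact below_trans (below_parent u) h

theorem depth_parent_le (v : V) : R.depth (R.parent v) ≤ R.depth v := by
  by_cases h : v = R.root
  · rw [h, R.parent_root]
  · exact (R.depth_parent_lt v h).le

theorem depth_le_of_below {u v : V} : R.Below u v → R.depth v ≤ R.depth u := by
  rintro ⟨n, rfl⟩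
  induction n with
  | zero => exact le_rfl
  | succ n ih =>
    rw [Function.iterate_succ_apply']
    exact (depth_parent_le _).trans ih

theorem root_below {v : V} (h : R.Below R.root v) : v = R.root := by
  obtain ⟨n, rfl⟩ := h
  induction n with
  | zero => rfl
  | succ n ih => rw [Function.iterate_succ_apply', ih, R.parent_root]

theorem below_antisymm {u v : V} (h : R.Below u v) (h' : R.Below v u) : u = v := by
  by_cases hu : u = R.root
  · subst hu
    exact (root_below h).symm
  · rcases below_iff.1 h with h | h
    · exact h
    · have h1 := depth_le_of_below h
      have h2 := depth_le_of_below h'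
      have h3 := R.depth_parent_lt u hu
      omega

theorem below_root (u : V) : R.Below u R.root := by
  induction hn : R.depth u using Nat.strong_induction_on generalizing u with
  | _ n ih =>
    by_cases hu : u = R.root
    · rw [hu]
      exact below_refl _
    · exact below_trans (below_parent u) (ih _ (hn ▸ R.depth_parent_lt u hu) _ rfl)

theorem below_total {u v w : V} : R.Below u v → R.Below u w → R.Below v w ∨ R.Below w v := by
  rintro ⟨m, rfl⟩ ⟨n, rfl⟩
  rcases le_total m n with h | h
  · obtain ⟨k, rfl⟩ := Nat.exists_eq_add_of_le' h
    exact Or.inl ⟨k, (Function.iterate_add_apply ..).symm⟩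
  · obtain ⟨k, rfl⟩ := Nat.exists_eq_add_of_le' h
    exact Or.inr ⟨k, (Function.iterate_add_apply ..).symm⟩

variable (R) in
/-- The descendant order of a rooted tree. -/
abbrev partialOrder : PartialOrder V where
  le := R.Below
  le_refl := below_refl
  le_trans _ _ _ := below_trans
  le_antisymm _ _ := below_antisymm

variable (R) in
/-- The root is the top element of the descendant order. -/
abbrev orderTop : @OrderTop V R.partialOrder.toLE :=
  let _ := R.partialOrder
  { top := R.root, le_top := below_root }

theorem parent_ne {v : V} (hv : v ≠ R.root) : R.parent v ≠ v := fun h => by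
  have := R.depth_parent_lt v hv
  rw [h] at this
  exact lt_irrefl _ this

theorem parentEdge_inj {u v : V} (hu : u ≠ R.root) (hv : v ≠ R.root)
    (h : s(u, R.parent u) = s(v, R.parent v)) : u = v := by
  rcases Sym2.eq_iff.1 h with h | ⟨h1, h2⟩
  · exact h.1
  · have h3 := R.depth_parent_lt u hu
    have h4 := R.depth_parent_lt v hv
    rw [h2] at h3
    rw [← h1] at h4
    omega

theorem separated_parent_iff {u v : V} (hu : u ≠ R.root) (hv : v ≠ R.root) :
    ¬ (R.Below u v ↔ R.Below (R.parent u) v) ↔ s(u, R.parent u) = s(v, R.parent v) := by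
  by_cases huv : u = v
  · subst huv
    refine iff_of_true (fun h => ?_) rfl
    exact parent_ne hu (below_antisymm (h.1 (below_refl u)) (below_parent u))
  · refine iff_of_false (fun h => h ?_) fun h => huv (parentEdge_inj hu hv h)
    rw [below_iff]
    tauto

theorem separated_adj_iff {u u' v : V} (h : T.Adj u u') (hv : v ≠ R.root) :
    ¬ (R.Below u v ↔ R.Below u' v) ↔ s(u, u') = s(v, R.parent v) := by
  have hroot : ∀ {x y : V}, T.Adj x y → R.parent x = y → x ≠ R.root := fun hxy hp hx => by
    rw [hx, R.parent_root] at hp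
    exact hxy.ne (hx.trans hp)
  rcases R.parent_eq_or u u' h with hp | hp
  · have := separated_parent_iff (hroot h hp) hv
    rwa [hp] at this
  · have := separated_parent_iff (hroot h.symm hp) hv
    rw [hp] at this
    rw [Sym2.eq_swap, ← this]
    tauto

open Classical in
/-- A walk changes between the inside and the outside of a subtree whenever it uses its top edge. -/
theorem separated_iff_odd_count {v : V} (hv : v ≠ R.root) {y z : V} (p : T.Walk y z) :
    ¬ (R.Below y v ↔ R.Below z v) ↔ Odd (p.edges.count s(v, R.parent v)) := by
  induction p with
  | nil => simp
  | @cons y y' z h p ih =>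
    have h1 := separated_adj_iff (R := R) h hv
    rw [SimpleGraph.Walk.edges_cons, List.count_cons]
    by_cases he : s(y, y') = s(v, R.parent v)
    · simp only [he, beq_self_eq_true, if_true, Nat.odd_add_one, ← ih]
      tauto
    · have : (s(y, y') == s(v, R.parent v)) = false := by simpa using he
      rw [this]
      simp only [Bool.false_eq_true, if_false, add_zero, ← ih]
      tauto

theorem separated_of_mem_edges {v : V} (hv : v ≠ R.root) {y z : V} {p : T.Walk y z}
    (hp : p.IsPath) (h : s(v, R.parent v) ∈ p.edges) : ¬ (R.Below y v ↔ R.Below z v) := by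
  classical
  rw [separated_iff_odd_count hv p, List.count_eq_one_of_mem hp.isTrail.edges_nodup h]
  exact odd_one

theorem exists_eq_parentEdge {f : Sym2 V} (hf : f ∈ T.edgeSet) :
    ∃ v, v ≠ R.root ∧ f = s(v, R.parent v) := by
  induction f using Sym2.ind with
  | _ x y =>
    have hxy : T.Adj x y := hf
    rcases R.parent_eq_or x y hxy with h | h
    · refine ⟨x, fun hx => ?_, by rw [h]⟩
      rw [hx, R.parent_root] at h
      exact hxy.ne (hx.trans h)
    · refine ⟨y, fun hy => ?_, by rw [h, Sym2.eq_swap]⟩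
      rw [hy, R.parent_root] at h
      exact hxy.ne' (hy.trans h)

/-- A graph containing all tree edges except perhaps the one above `v`, and an edge that leaves the
subtree of `v`, is connected. -/
theorem connected_of_separated {G : SimpleGraph V} {v : V}
    (hG : ∀ u, u ≠ R.root → u ≠ v → G.Adj u (R.parent u)) {p q : V} (hpq : G.Adj p q)
    (hsep : ¬ (R.Below p v ↔ R.Below q v)) : G.Connected := by
  have hout : ∀ u, ¬ R.Below u v → G.Reachable R.root u := by
    intro u
    induction hn : R.depth u using Nat.strong_induction_on generalizing u with
    | _ n ih =>
      intro hu
      by_cases hr : u = R.root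
      · rw [hr]
      · have huv : u ≠ v := fun h => hu (h ▸ below_refl u)
        have := ih _ (hn ▸ R.depth_parent_lt u hr) _ rfl
          fun h => hu (below_trans (below_parent u) h)
        exact this.trans (hG u hr huv).symm.reachable
  have hin : ∀ u, R.Below u v → G.Reachable v u := by
    intro u
    induction hn : R.depth u using Nat.strong_induction_on generalizing u with
    | _ n ih =>
      intro hu
      by_cases huv : u = v
      · rw [huv]
      · have hr : u ≠ R.root := fun h => huv (by
          subst h
          exact (root_below hu).symm)
        have := ih _ (hn ▸ R.depth_parent_lt u hr) _ rfl
          ((below_iff.1 hu).resolve_left huv)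
        exact this.trans (hG u hr huv).symm.reachable
  have hv : G.Reachable R.root v := by
    by_cases h1 : R.Below p v
    · have h2 : ¬ R.Below q v := by tauto
      exact ((hout q h2).trans hpq.symm.reachable).trans (hin p h1).symm
    · have h2 : R.Below q v := by tauto
      exact ((hout p h1).trans hpq.reachable).trans (hin q h2).symm
  rw [SimpleGraph.connected_iff_exists_forall_reachable]
  refine ⟨R.root, fun u => ?_⟩
  by_cases hu : R.Below u v
  · exact hv.trans (hin u hu)
  · exact hout u hu

end Rooting

/-- The parent of a node is a neighbour that is closer to the root. As there are as many edges
between nodes and their parents as there are edges in the tree, there are no other tree edges. -/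
theorem exists_rooting [Finite V] {T : SimpleGraph V} (hT : T.IsTree) : Nonempty (Rooting T) := by
  classical
  have := Fintype.ofFinite V
  have hconn := hT.connected
  obtain ⟨r⟩ := hconn.nonempty
  have hex : ∀ v, ∃ w, (v = r → w = r) ∧ (v ≠ r → T.Adj v w ∧ T.dist w r < T.dist v r) := by
    intro v
    by_cases hv : v = r
    · exact ⟨r, fun _ => rfl, fun h => absurd hv h⟩
    · obtain ⟨p, hp⟩ := hconn.exists_walk_length_eq_dist v r
      cases p with
      | nil => exact absurd rfl hv
      | @cons _ w _ h p =>
        refine ⟨w, fun h => absurd h hv, fun _ => ⟨h, ?_⟩⟩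
        have := SimpleGraph.dist_le p
        rw [SimpleGraph.Walk.length_cons] at hp
        omega
  choose par hpar using hex
  have hinj : Set.InjOn (fun v => s(v, par v)) ((Finset.univ.erase r : Finset V) : Set V) := by
    intro u hu v hv h
    have hu' : u ≠ r := by simpa using hu
    have hv' : v ≠ r := by simpa using hv
    rcases Sym2.eq_iff.1 h with h | ⟨h1, h2⟩
    · exact h.1
    · have h3 := ((hpar u).2 hu').2
      have h4 := ((hpar v).2 hv').2
      rw [h2] at h3
      rw [← h1] at h4
      omega
  have himg : (Finset.univ.erase r).image (fun v => s(v, par v)) = T.edgeFinset := by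
    refine Finset.eq_of_subset_of_card_le ?_ ?_
    · intro f hf
      obtain ⟨v, hv, rfl⟩ := Finset.mem_image.1 hf
      rw [SimpleGraph.mem_edgeFinset]
      exact ((hpar v).2 (by simpa using hv)).1
    · have := hT.card_edgeFinset
      rw [Finset.card_image_of_injOn hinj, Finset.card_erase_of_mem (Finset.mem_univ r),
        Finset.card_univ]
      omega
  refine ⟨⟨r, par, fun v => T.dist v r, (hpar r).1 rfl, fun v hv => ((hpar v).2 hv).2,
    fun v hv => ((hpar v).2 hv).1, fun u v huv => ?_⟩⟩
  have : s(u, v) ∈ (Finset.univ.erase r).image (fun v => s(v, par v)) := by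
    rw [himg, SimpleGraph.mem_edgeFinset]
    exact huv
  obtain ⟨w, -, hw⟩ := Finset.mem_image.1 this
  rcases Sym2.eq_iff.1 hw with ⟨rfl, h⟩ | ⟨rfl, h⟩
  · exact Or.inl h
  · exact Or.inr h

/-! ### The integrality gap -/

namespace Inst

variable {I : Inst V} (R : Rooting I.T)

theorem isTwoEdgeConnected_of_separated {J : Finset (Sym2 V)}
    (hJ : ∀ v, v ≠ R.root → ∃ p q, s(p, q) ∈ J ∧ ¬ (R.Below p v ↔ R.Below q v)) :
    IsTwoEdgeConnected
      (Sum.elim (fun f : I.T.edgeSet => (f : Sym2 V)) (fun e : {e // e ∈ J} => (e : Sym2 V))) := by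
  constructor
  · refine I.isTree.connected.mono fun u v huv => ?_
    rw [SimpleGraph.fromEdgeSet_adj]
    exact ⟨⟨Sum.inl ⟨s(u, v), huv⟩, rfl⟩, huv.ne⟩
  · rintro (⟨f, hf⟩ | e)
    · obtain ⟨v, hv, rfl⟩ := R.exists_eq_parentEdge hf
      obtain ⟨p, q, hpqJ, hsep⟩ := hJ v hv
      refine Rooting.connected_of_separated (R := R) (v := v) (p := p) (q := q) ?_ ?_ hsep
      · intro u hu huv
        rw [SimpleGraph.fromEdgeSet_adj]
        refine ⟨⟨Sum.inl ⟨s(u, R.parent u), R.adj_parent u hu⟩, ?_, rfl⟩, (R.adj_parent u hu).ne⟩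
        intro h
        have h' := Sum.inl.inj (Set.mem_singleton_iff.1 h)
        exact huv (Rooting.parentEdge_inj hu hv (Subtype.ext_iff.1 h'))
      · rw [SimpleGraph.fromEdgeSet_adj]
        refine ⟨⟨Sum.inr ⟨s(p, q), hpqJ⟩, by simp, rfl⟩, ?_⟩
        rintro rfl
        exact hsep Iff.rfl
    · refine I.isTree.connected.mono fun u v huv => ?_
      rw [SimpleGraph.fromEdgeSet_adj]
      exact ⟨⟨Sum.inl ⟨s(u, v), huv⟩, by simp, rfl⟩, huv.ne⟩

theorem separated_of_covers {p q v : V} (hv : v ≠ R.root) (h : I.Covers s(p, q) s(v, R.parent v)) :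
    ¬ (R.Below p v ↔ R.Below q v) := by
  obtain ⟨y, z, w, hyz, hw, hmem⟩ := h
  have := R.separated_of_mem_edges hv hw hmem
  rcases Sym2.eq_iff.1 hyz with ⟨rfl, rfl⟩ | ⟨rfl, rfl⟩ <;> tauto

theorem isBunch_singleton {v : V} (hv : v ≠ R.root) : I.IsBunch {s(v, R.parent v)} := by
  refine ⟨fun f hf => ?_, by simp, fun y z p _ D hD hcard => ?_⟩
  · rw [Finset.mem_singleton.1 hf]
    exact R.adj_parent v hv
  · have := Finset.card_le_card hD
    rw [hcard, Finset.card_singleton] at this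
    omega

open Classical in
/-- The edges above `u`, `v` and `w`, where `u`, `v` are incomparable and below `w`, form a bunch: a
path through the edges above `u` and `v` has one end below each of them, so both below `w`. -/
theorem isBunch_fork {u v w : V} (hw : w ≠ R.root) (huw : R.Below u w) (hvw : R.Below v w)
    (huw' : u ≠ w) (hvw' : v ≠ w) (huv : ¬ R.Below u v) (hvu : ¬ R.Below v u) :
    I.IsBunch {s(u, R.parent u), s(v, R.parent v), s(w, R.parent w)} ∧
      ({s(u, R.parent u), s(v, R.parent v), s(w, R.parent w)} : Finset (Sym2 V)).card = 3 := by
  have hu : u ≠ R.root := fun h => huw' (by subst h; exact (R.root_below huw).symm)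
  have hv : v ≠ R.root := fun h => hvw' (by subst h; exact (R.root_below hvw).symm)
  have huv' : u ≠ v := fun h => huv (h ▸ R.below_refl u)
  have hcard : ({s(u, R.parent u), s(v, R.parent v), s(w, R.parent w)} : Finset (Sym2 V)).card = 3 :=
    Finset.card_eq_three.2 ⟨_, _, _, fun h => huv' (R.parentEdge_inj hu hv h),
      fun h => huw' (R.parentEdge_inj hu hw h), fun h => hvw' (R.parentEdge_inj hv hw h), rfl⟩
  refine ⟨⟨fun f hf => ?_, by rw [hcard]; decide, fun y z p hp D hD hDcard hmem => ?_⟩, hcard⟩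
  · simp only [Finset.mem_insert, Finset.mem_singleton] at hf
    rcases hf with rfl | rfl | rfl
    · exact R.adj_parent u hu
    · exact R.adj_parent v hv
    · exact R.adj_parent w hw
  · rw [Finset.eq_of_subset_of_card_le hD (by rw [hcard, hDcard])] at hmem
    have h1 := R.separated_of_mem_edges hu hp (hmem _ (by simp))
    have h2 := R.separated_of_mem_edges hv hp (hmem _ (by simp))
    have h3 := R.separated_of_mem_edges hw hp (hmem _ (by simp))
    have h4 : ∀ t, R.Below t u → R.Below t w := fun t h => R.below_trans h huw
    have h5 : ∀ t, R.Below t v → R.Below t w := fun t h => R.below_trans h hvw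
    have h6 : ∀ t, R.Below t u → ¬ R.Below t v := fun t h h' => by
      rcases R.below_total h h' with h | h
      · exact huv h
      · exact hvu h
    by_cases hy : R.Below y u
    · by_cases hz : R.Below z v
      · exact h3 (iff_of_true (h4 y hy) (h5 z hz))
      · exact h2 (iff_of_false (h6 y hy) hz)
    · have hz : R.Below z u := by
        by_contra hz
        exact h1 (iff_of_false hy hz)
      by_cases hy' : R.Below y v
      · exact h3 (iff_of_true (h5 y hy') (h4 z hz))
      · exact h2 (iff_of_false hy' (h6 z hz))

theorem exists_solution [Finite V] (I : Inst V) {x : {e // e ∈ I.E} → ℝ}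
    (hx : x ∈ I.bunchPolyhedron 3) :
    ∃ J, I.IsSolution J ∧ (J.card : ℝ) ≤ 7 / 4 * ∑ e, x e := by
  classical
  have := Fintype.ofFinite V
  obtain ⟨R⟩ := exists_rooting I.isTree
  obtain ⟨hbunch, hnn⟩ := hx
  let a : {e // e ∈ I.E} → V := fun e => (Quot.out e.1).1
  let b : {e // e ∈ I.E} → V := fun e => (Quot.out e.1).2
  have hab : ∀ e, s(a e, b e) = e.1 := fun e => Quot.out_eq e.1
  -- loops cover nothing, so their weight can be dropped
  let x' : {e // e ∈ I.E} → ℝ := fun e => if a e = b e then 0 else x e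
  have hx' : ∀ e, 0 ≤ x' e := fun e => by
    simp only [x']
    split_ifs <;> simp [hnn]
  have hx'le : ∑ e, x' e ≤ ∑ e, x e := Finset.sum_le_sum fun e _ => by
    simp only [x']
    split_ifs <;> simp [hnn]
  have hpsi : ∀ (B : Finset (Sym2 V)) (P : {e // e ∈ I.E} → Prop),
      (∀ e, (∃ f ∈ B, I.Covers e.1 f) → a e ≠ b e ∧ P e) →
      ∑ e ∈ I.psi B, x e ≤ weight x' P := by
    intro B P h
    unfold psi weight
    rw [Finset.sum_filter]
    refine Finset.sum_le_sum fun e _ => ?_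
    by_cases he : ∃ f ∈ B, I.Covers e.1 f
    · have := h e he
      rw [if_pos he, if_pos this.2]
      simp [x', this.1]
    · rw [if_neg he]
      split_ifs <;> simp [hx']
  let _ := R.partialOrder
  let _ := R.orderTop
  have hsep : ∀ e v, v ≠ R.root → I.Covers e.1 s(v, R.parent v) →
      a e ≠ b e ∧ Separates v (a e) (b e) := fun e v hv h => by
    rw [← hab e] at h
    have h' := separated_of_covers R hv h
    exact ⟨fun h => h' (by rw [h]), h'⟩
  obtain ⟨J, hJ, hcard⟩ := exists_card_le_of_rooted (V := V) (fun u v w => R.below_total)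
    a b x' hx' (fun e h => if_pos h) (fun v hv => by
      have h1 := hbunch _ (isBunch_singleton R hv) (by simp)
      have h2 := hpsi {s(v, R.parent v)} (fun e => Separates v (a e) (b e)) (by
        rintro e ⟨f, hf, hef⟩
        rw [Finset.mem_singleton.1 hf] at hef
        exact hsep e v hv hef)
      rw [Finset.card_singleton] at h1
      norm_num at h1
      exact h1.trans h2) (fun u v w hw huw hvw huv hvu => by
      obtain ⟨hB, hB3⟩ := isBunch_fork R hw huw.le hvw.le huw.ne hvw.ne huv hvu
      have hu : u ≠ R.root := (huw.trans_le le_top).ne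
      have hv : v ≠ R.root := (hvw.trans_le le_top).ne
      have h1 := hbunch _ hB hB3.le
      have h2 := hpsi {s(u, R.parent u), s(v, R.parent v), s(w, R.parent w)}
        (fun e => Separates u (a e) (b e) ∨ Separates v (a e) (b e) ∨ Separates w (a e) (b e)) (by
        rintro e ⟨f, hf, hef⟩
        simp only [Finset.mem_insert, Finset.mem_singleton] at hf
        rcases hf with rfl | rfl | rfl
        · exact ⟨(hsep e u hu hef).1, Or.inl (hsep e u hu hef).2⟩
        · exact ⟨(hsep e v hv hef).1, Or.inr (Or.inl (hsep e v hv hef).2)⟩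
        · exact ⟨(hsep e w hw hef).1, Or.inr (Or.inr (hsep e w hw hef).2)⟩)
      rw [hB3] at h1
      norm_num at h1
      exact h1.trans h2)
  refine ⟨J.map (Function.Embedding.subtype _), ⟨?_, ?_⟩, ?_⟩
  · intro e he
    obtain ⟨e', -, rfl⟩ := Finset.mem_map.1 he
    exact e'.2
  · refine isTwoEdgeConnected_of_separated R fun v hv => ?_
    obtain ⟨e, he, hsep⟩ := hJ v hv
    refine ⟨a e, b e, ?_, hsep⟩
    rw [hab e]
    exact Finset.mem_map_of_mem _ he
  · rw [Finset.card_map]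
    linarith

theorem opt_le_mul_bunchLPValue [Finite V] (I : Inst V) : I.opt ≤ 7 / 4 * I.bunchLPValue 3 := by
  have h74 : (7 / 4 : ℝ≥0∞) = ENNReal.ofReal (7 / 4) := by
    rw [ENNReal.ofReal_div_of_pos (by norm_num)]
    norm_num
  have h0 : (7 / 4 : ℝ≥0∞) ≠ 0 := by rw [h74]; simp
  have htop : (7 / 4 : ℝ≥0∞) ≠ ∞ := by rw [h74]; exact ENNReal.ofReal_ne_top
  unfold bunchLPValue
  rw [ENNReal.mul_iInf_of_ne h0 htop]
  refine le_iInf fun x => ?_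
  rw [ENNReal.mul_iInf_of_ne h0 htop]
  refine le_iInf fun hx => ?_
  obtain ⟨J, hJ, hcard⟩ := I.exists_solution hx
  refine (iInf₂_le J hJ).trans ?_
  rw [h74, ← ENNReal.ofReal_mul (by norm_num), ← ENNReal.ofReal_natCast]
  exact ENNReal.ofReal_le_ofReal hcard

end Inst

end Graph

end TreeAug

theorem theorem3 : TreeAug.bunchIntegralityGap.{u} 3 ≤ 7 / 4 := by
  refine iSup_le fun V => iSup_le fun _ => iSup_le fun I => ?_
  exact ENNReal.div_le_of_le_mul I.opt_le_mul_bunchLPValue
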